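/- Let $T>0$, $1<p<\infty$ and $0<\alpha\le 1$ with $\frac1p+\alpha>1$. Let $\mathrm{Conv}(\mathbb R^d)$ be the family of nonempty compact convex subsets of $\mathbb R^d$ with the Hausdorff metric $H$ and Minkowski addition, and put $\|A\|=H(A,\{0\})$. For a metric space $(E,\rho)$, $BV_p(E)$ is the set of $f:[0,T]\to E$ with finite Riesz $p$-variation $$V_p(f)=\sup_{0=t_0<\dots<t_n=T}\ \sum_{i=1}^n\frac{\rho(f(t_{i-1}),f(t_i))^p}{(t_i-t_{i-1})^{p-1}},$$ and, for a normed space $X$, $C^\alpha(X)$ is the space of $f:[0,T]\to X$ with finite norm $\|f\|_\alpha=\sup_{t}\|f(t)\|+\sup_{s<t}\frac{\|f(t)-f(s)\|}{(t-s)^\alpha}$. A function $F:[0,T]\to\mathrm{Conv}(\mathbb R^d)$ is Hukuhara differentiable if for every $t\in[0,T]$ there is $D_HF(t)\in\mathrm{Conv}(\mathbb R^d)$ which is the limit, as $h\to0^+$, of $\frac1h\,(F(t+h)\div F(t))$ (if $t<T$) and of $\frac1h\,(F(t)\div F(t-h))$ (if $t>0$), where $A\div B$ denotes the set $C\in\mathrm{Conv}(\mathbb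 R^d)$ with $A=B+C$, required to exist for all small $h>0$. The derivative is $p$-integrably bounded if $\|D_HF(t)\|\le k(t)$ for a.e. $t\in[0,T]$ with some $k\in L^p([0,T])$. Let $$\mathcal{IS}(F)=\{f\in BV_p(\mathbb R^d):\ f(t)\in F(t)\ \text{for all } t\in[0,T],\ f'\in L^p([0,T]),\ f'(t)\in D_HF(t)\ \text{for a.e. } t\in[0,T]\}.$$ For $g\in C^\alpha(\mathbb R)$ and $0\le s\le t\le T$ let $\int_s^t f\,dg$ be the limit of the Riemann sums $\sum_i f(t_{i-1})(g(t_i)-g(t_{i-1}))$ over partitions of $[s,t]$ with mesh tending to $0$. Let $(\mathcal{IS})\int_s^tF\,dg$ be the closure in $\mathbb R^d$ of $\{\int_s^tf\,dg: f\in\mathcal{IS}(F)\}$, and let $(\mathcal{IS})\int_0^{\cdot}F\,dg$ be the closure in $\|\cdot\|_\alpha$ of $\{\int_0^{\cdot}f\,dg: f\in\mathcal{IS}(F)\}$. Let $g\in C^\alpha(\mathbb R)$ and let $F,F_1,F_2\in BV_p(\mathrm{Conv}(\mathbb R^d))$ be Hukuhara differentiable with $p$-integrably bounded Hukuhara derivatives.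 Then the integral $\int_s^tf\,dg$ exists for every $f\in\mathcal{IS}(F)$ and all $0\le s\le t\le T$, the function $F_1+F_2$ belongs to $BV_p(\mathrm{Conv}(\mathbb R^d))$ and is Hukuhara differentiable, and $$(\mathcal{IS})\int_0^t(F_1+F_2)\,dg=(\mathcal{IS})\int_0^tF_1\,dg+(\mathcal{IS})\int_0^tF_2\,dg\qquad\text{for every }t\in[0,T].$$ Moreover, if $F(0)$ is bounded in $\mathbb R^d$ (which always holds, since $F(0)$ is compact), then $(\mathcal{IS})\int_0^{\cdot}F\,dg$ is a bounded set in $C^\alpha(\mathbb R^d)$, and $(\mathcal{IS})\int_s^tF\,dg$ is a bounded set in $\mathbb R^d$ for all $0\le s\le t\le T$. -/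

import Mathlib

open Set Filter Topology MeasureTheory
open scoped ENNReal NNReal Pointwise

noncomputable section

namespace SetYoung

/-- A finite partition `a = t₀ < t₁ < ⋯ < tₙ = b` of `[a, b]`
(only the values `pt 0, …, pt n` matter). -/
structure IntervalPartition (a b : ℝ) where
  n : ℕ
  pt : ℕ → ℝ
  pt_zero : pt 0 = a
  pt_last : pt n = b
  pt_lt : ∀ i < n, pt i < pt (i + 1)

/-- The Riesz `p`-variation of `f` on `[a, b]`, with values in `[0, ∞]`. -/
def rieszVar {M : Type*} [PseudoEMetricSpace M] (p : ℝ) (f : ℝ → M) (a b : ℝ) : ℝ≥0∞ :=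
  ⨆ P : IntervalPartition a b, ∑ i ∈ Finset.range P.n,
    edist (f (P.pt i)) (f (P.pt (i + 1))) ^ p /
      ENNReal.ofReal ((P.pt (i + 1) - P.pt i) ^ (p - 1))

/-- `f ∈ BV_p([0, T], M)`. Functions on `[0, T]` are represented by functions on `ℝ` of which only
the restriction to `[0, T]` is used. -/
def MemBV {M : Type*} [PseudoEMetricSpace M] (p T : ℝ) (f : ℝ → M) : Prop :=
  rieszVar p f 0 T < ⊤

/-- The Hölder norm `‖f‖_β = ‖f‖_∞ + M_β(f)` on `[0, T]`, with values in `[0, ∞]`. -/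
def holderNorm {X : Type*} [NormedAddCommGroup X] (T β : ℝ) (f : ℝ → X) : ℝ≥0∞ :=
  (⨆ t ∈ Icc 0 T, ‖f t‖ₑ) +
    ⨆ s ∈ Icc 0 T, ⨆ t ∈ Icc 0 T, ⨆ _ : s < t,
      ‖f t - f s‖ₑ / ENNReal.ofReal ((t - s) ^ β)

/-- `f ∈ C^β(X)`: the Hölder norm on `[0, T]` is finite. -/
def MemHolder {X : Type*} [NormedAddCommGroup X] (T β : ℝ) (f : ℝ → X) : Prop :=
  holderNorm T β f < ⊤

section Convex

variable {X : Type*} [NormedAddCommGroup X] [NormedSpace ℝ X]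

/-- `D` is the Hukuhara derivative at `t` of `F : [0, T] → Conv(X)`. `ConvexBody X` is the space of
nonempty compact convex sets with the Minkowski operations and the Hausdorff metric; `C h` is the
Hukuhara difference `F (t + h) ÷ F t`, respectively `F t ÷ F (t - h)`. At the endpoints of `[0, T]`
only the one-sided limit that makes sense is required. -/
def HasHukuharaDerivAt (T : ℝ) (F : ℝ → ConvexBody X) (t : ℝ) (D : ConvexBody X) : Prop :=
  (t < T → ∃ C : ℝ → ConvexBody X,
    (∀ᶠ h in 𝓝[>] (0 : ℝ), F (t + h) = F t + C h) ∧
      Tendsto (fun h : ℝ => h⁻¹ • C h) (𝓝[>] 0) (𝓝 D)) ∧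
  (0 < t → ∃ C : ℝ → ConvexBody X,
    (∀ᶠ h in 𝓝[>] (0 : ℝ), F t = F (t - h) + C h) ∧
      Tendsto (fun h : ℝ => h⁻¹ • C h) (𝓝[>] 0) (𝓝 D))

/-- `F` is Hukuhara differentiable at every point of `[0, T]`. -/
def HukuharaDifferentiable (T : ℝ) (F : ℝ → ConvexBody X) : Prop :=
  ∀ t ∈ Icc 0 T, ∃ D, HasHukuharaDerivAt T F t D

open Classical in
/-- The Hukuhara derivative `D_H F` (with the value `{0}` where it does not exist). -/
def hukuharaDeriv (T : ℝ) (F : ℝ → ConvexBody X) (t : ℝ) : ConvexBody X :=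
  if h : ∃ D, HasHukuharaDerivAt T F t D then h.choose else 0

/-- `Φ` is `p`-integrably bounded on `[0, T]`: `‖Φ t‖ = H(Φ t, {0}) ≤ k t` for almost all `t`, with
some `k ∈ L^p([0, T])`. -/
def PIntegrablyBounded (p T : ℝ) (Φ : ℝ → ConvexBody X) : Prop :=
  ∃ k : ℝ → ℝ, MemLp k (ENNReal.ofReal p) (volume.restrict (Icc 0 T)) ∧
    ∀ᵐ t ∂(volume.restrict (Icc 0 T)), dist (Φ t) 0 ≤ k t

/-- `S_{V_p}(F)`: the selections of `F` with bounded Riesz `p`-variation. -/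
def selV (p T : ℝ) (F : ℝ → ConvexBody X) : Set (ℝ → X) :=
  {f | MemBV p T f ∧ ∀ t ∈ Icc 0 T, f t ∈ F t}

/-- `S_{L^p}(Φ)`: the `p`-integrable almost everywhere selections of `Φ`. -/
def selL (p T : ℝ) (Φ : ℝ → ConvexBody X) : Set (ℝ → X) :=
  {φ | MemLp φ (ENNReal.ofReal p) (volume.restrict (Icc 0 T)) ∧
    ∀ᵐ t ∂(volume.restrict (Icc 0 T)), φ t ∈ Φ t}

/-- `IS(F)`: the selections `f ∈ S_{V_p}(F)` with `f' ∈ S_{L^p}(D_H F)`. -/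
def IS (p T : ℝ) (F : ℝ → ConvexBody X) : Set (ℝ → X) :=
  {f | f ∈ selV p T F ∧ deriv f ∈ selL p T (hukuharaDeriv T F)}

/-- `I` is the Young integral `∫_s^t f dg`: the limit of the left-point Riemann sums as the mesh of
the partition of `[s, t]` tends to `0`. -/
def HasYoungIntegral (f : ℝ → X) (g : ℝ → ℝ) (s t : ℝ) (I : X) : Prop :=
  ∀ ε > 0, ∃ δ > 0, ∀ P : IntervalPartition s t,
    (∀ i < P.n, P.pt (i + 1) - P.pt i < δ) →
      ‖∑ i ∈ Finset.range P.n, (g (P.pt (i + 1)) - g (P.pt i)) • f (P.pt i) - I‖ < ε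

/-- The set-valued Young integral `(IS)∫_s^t F dg`: the closure of `{∫_s^t f dg : f ∈ IS(F)}`. -/
def setYoung (p T : ℝ) (F : ℝ → ConvexBody X) (g : ℝ → ℝ) (s t : ℝ) : Set X :=
  closure {I | ∃ f ∈ IS p T F, HasYoungIntegral f g s t I}

/-- The set of paths `(IS)∫_0^· F dg`: the closure, in the norm of `C^α(X)`, of the set of the
indefinite integrals `k = ∫_0^· f dg` on `[0, T]`, `f ∈ IS(F)`. -/
def setYoungPath (p T α : ℝ) (F : ℝ → ConvexBody X) (g : ℝ → ℝ) : Set (ℝ → X) :=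
  {h | ∀ ε > 0, ∃ f ∈ IS p T F, ∃ k : ℝ → X,
    (∀ t ∈ Icc 0 T, HasYoungIntegral f g 0 t (k t)) ∧ holderNorm T α (h - k) < ε}

end Convex

end SetYoung

end

/-! Additivity rests on the identity IS(F₁ + F₂) = IS(F₁) + IS(F₂). The inclusion ⊇ (`add_mem_IS`)
follows from additivity of the Hukuhara derivative. For ⊆ (`exists_add_eq_of_mem_IS_add`), let f ∈
IS(F₁ + F₂) and f(0) = x₁ + x₂ with xᵢ ∈ Fᵢ(0). Since f' ∈ D_H F₁ + D_H F₂ a.e., there is a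
measurable selection φ of D_H F₁ with f' - φ ∈ D_H F₂ a.e. (`exists_measurable_mem_hukuharaDeriv`);
take f₁ = x₁ + ∫φ and f₂ = f - f₁.

That such primitives stay inside F (`HukuharaDifferentiable.add_integral_mem`) is seen through
support functions. They are additive for Minkowski sums, so t ↦ supp (F t) ξ is a real function with
derivative supp (D_H F t) ξ; integrating ⟪ξ, φ⟫ ≤ supp (D_H F) ξ gives the membership for each ξ.

Finite Riesz variation with p > 1 makes f absolutely continuous, so the Young integral exists by
integration by parts against the continuous g (`hasYoungIntegral_partsIntegral`). The same formula
bounds it by a constant times (t - s)^α, uniformly over IS(F), because ‖f(0)‖ ≤ ‖F(0)‖ and ‖f'‖ ≤ k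
a.e. This yields both boundedness claims. It also makes the sets of integrals relatively compact in
finite dimension, so the closure of their sum is the sum of their closures. -/

noncomputable section

namespace SetYoung

/-! ### Support functions of convex bodies. -/

section Support

variable {E : Type*} [NormedAddCommGroup E]

section Normed

variable [NormedSpace ℝ E]

lemma exists_mem_dist_le (K L : ConvexBody E) {x : E} (hx : x ∈ K) :
    ∃ y ∈ L, dist x y ≤ dist K L := by
  obtain ⟨y, hy, h⟩ := L.isCompact.exists_infDist_eq_dist L.nonempty x
  refine ⟨y, hy, ?_⟩
  rw [← h]
  exact Metric.infDist_le_hausdorffDist_of_mem hx ConvexBody.hausdorffEDist_ne_top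

lemma dist_le_of_forall_exists_mem {K L : ConvexBody E} {r : ℝ}
    (h₁ : ∀ x ∈ K, ∃ y ∈ L, dist x y ≤ r) (h₂ : ∀ x ∈ L, ∃ y ∈ K, dist x y ≤ r) :
    dist K L ≤ r := by
  obtain ⟨x, hx⟩ := K.nonempty
  obtain ⟨y, -, hy⟩ := h₁ x hx
  exact Metric.hausdorffDist_le_of_mem_dist (dist_nonneg.trans hy) h₁ h₂

lemma convexBody_dist_add_add_le (A B C D : ConvexBody E) :
    dist (A + B) (C + D) ≤ dist A C + dist B D := by
  have key : ∀ A B C D : ConvexBody E, ∀ x ∈ A + B, ∃ y ∈ C + D,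
      dist x y ≤ dist A C + dist B D := by
    rintro A B C D _ ⟨a, ha, b, hb, rfl⟩
    obtain ⟨c, hc, hac⟩ := exists_mem_dist_le A C ha
    obtain ⟨d, hd, hbd⟩ := exists_mem_dist_le B D hb
    exact ⟨c + d, Set.add_mem_add hc hd, (dist_add_add_le _ _ _ _).trans (add_le_add hac hbd)⟩
  refine dist_le_of_forall_exists_mem (key A B C D) fun x hx => ?_
  simpa only [dist_comm] using key C D A B x hx

lemma convexBody_edist_add_add_le (A B C D : ConvexBody E) :
    edist (A + B) (C + D) ≤ edist A C + edist B D := by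
  rw [edist_dist, edist_dist, edist_dist, ← ENNReal.ofReal_add dist_nonneg dist_nonneg]
  exact ENNReal.ofReal_le_ofReal (convexBody_dist_add_add_le A B C D)

lemma tendsto_convexBody_add {ι : Type*} {l : Filter ι} {u v : ι → ConvexBody E}
    {A B : ConvexBody E} (hu : Tendsto u l (𝓝 A)) (hv : Tendsto v l (𝓝 B)) :
    Tendsto (fun i => u i + v i) l (𝓝 (A + B)) := by
  rw [tendsto_iff_dist_tendsto_zero] at hu hv ⊢
  exact squeeze_zero (fun _ => dist_nonneg) (fun i => convexBody_dist_add_add_le _ _ _ _)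
    (by simpa using hu.add hv)

lemma norm_le_dist_zero {K : ConvexBody E} {x : E} (hx : x ∈ K) : ‖x‖ ≤ dist K 0 := by
  obtain ⟨y, hy, h⟩ := exists_mem_dist_le K 0 hx
  have : y = 0 := hy
  rwa [this, dist_zero_right] at h

end Normed

variable [InnerProductSpace ℝ E]

/-- The support function `ξ ↦ max {⟪ξ, x⟫ : x ∈ K}` of a convex body `K`. -/
def supp (K : ConvexBody E) (ξ : E) : ℝ := sSup ((fun x => inner ℝ ξ x) '' (K : Set E))

lemma isCompact_inner_image (K : ConvexBody E) (ξ : E) :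
    IsCompact ((fun x => inner ℝ ξ x) '' (K : Set E)) :=
  K.isCompact.image (by fun_prop)

lemma inner_le_supp {K : ConvexBody E} (ξ : E) {x : E} (hx : x ∈ K) :
    inner ℝ ξ x ≤ supp K ξ :=
  le_csSup (isCompact_inner_image K ξ).bddAbove ⟨x, hx, rfl⟩

lemma exists_inner_eq_supp (K : ConvexBody E) (ξ : E) : ∃ x ∈ K, inner ℝ ξ x = supp K ξ :=
  (isCompact_inner_image K ξ).sSup_mem (K.nonempty.image _)

lemma supp_le_iff {K : ConvexBody E} {ξ : E} {r : ℝ} :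
    supp K ξ ≤ r ↔ ∀ x ∈ K, inner ℝ ξ x ≤ r := by
  refine ⟨fun h x hx => (inner_le_supp ξ hx).trans h, fun h => ?_⟩
  obtain ⟨x, hx, hx'⟩ := exists_inner_eq_supp K ξ
  exact hx' ▸ h x hx

/-- Through this identity a Hukuhara difference becomes an ordinary difference of real numbers. -/
lemma supp_add (K L : ConvexBody E) (ξ : E) : supp (K + L) ξ = supp K ξ + supp L ξ := by
  apply le_antisymm
  · rw [supp_le_iff]
    rintro _ ⟨a, ha, b, hb, rfl⟩
    simp only [inner_add_right]
    exact add_le_add (inner_le_supp ξ ha) (inner_le_supp ξ hb)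
  · obtain ⟨a, ha, ha'⟩ := exists_inner_eq_supp K ξ
    obtain ⟨b, hb, hb'⟩ := exists_inner_eq_supp L ξ
    rw [← ha', ← hb', ← inner_add_right]
    exact inner_le_supp ξ (Set.add_mem_add ha hb)

lemma supp_smul {c : ℝ} (hc : 0 ≤ c) (K : ConvexBody E) (ξ : E) :
    supp (c • K) ξ = c * supp K ξ := by
  apply le_antisymm
  · rw [supp_le_iff]
    rintro _ ⟨a, ha, rfl⟩
    simp only [inner_smul_right]
    exact mul_le_mul_of_nonneg_left (inner_le_supp ξ ha) hc
  · obtain ⟨a, ha, ha'⟩ := exists_inner_eq_supp K ξ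
    rw [← ha', ← inner_smul_right]
    exact inner_le_supp ξ (Set.smul_mem_smul_set ha)

lemma supp_sub_supp_le (K L : ConvexBody E) (ξ : E) :
    supp K ξ - supp L ξ ≤ ‖ξ‖ * dist K L := by
  obtain ⟨x, hx, hx'⟩ := exists_inner_eq_supp K ξ
  obtain ⟨y, hy, hxy⟩ := exists_mem_dist_le K L hx
  calc supp K ξ - supp L ξ ≤ inner ℝ ξ x - inner ℝ ξ y := by
        rw [hx']; gcongr; exact inner_le_supp ξ hy
    _ = inner ℝ ξ (x - y) := (inner_sub_right _ _ _).symm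
    _ ≤ ‖ξ‖ * ‖x - y‖ := real_inner_le_norm _ _
    _ ≤ ‖ξ‖ * dist K L := by rw [← dist_eq_norm]; gcongr

lemma abs_supp_sub_supp_le (K L : ConvexBody E) (ξ : E) :
    |supp K ξ - supp L ξ| ≤ ‖ξ‖ * dist K L :=
  abs_le.2 ⟨by have := supp_sub_supp_le L K ξ; rw [dist_comm] at this; linarith,
    supp_sub_supp_le K L ξ⟩

lemma lipschitzWith_supp_left (ξ : E) :
    LipschitzWith ‖ξ‖₊ fun K : ConvexBody E => supp K ξ :=
  LipschitzWith.of_dist_le_mul fun K L => by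
    simpa [Real.dist_eq] using abs_supp_sub_supp_le K L ξ

lemma abs_supp_le (K : ConvexBody E) (ξ : E) : |supp K ξ| ≤ ‖ξ‖ * dist K 0 := by
  obtain ⟨x, hx, hx'⟩ := exists_inner_eq_supp K ξ
  rw [← hx']
  exact (abs_real_inner_le_norm _ _).trans (by gcongr; exact norm_le_dist_zero hx)

lemma continuous_supp (K : ConvexBody E) : Continuous (supp K) := by
  have key : ∀ ξ η : E, supp K ξ ≤ supp K η + dist K 0 * dist ξ η := by
    intro ξ η
    rw [supp_le_iff]
    intro x hx
    have h1 : inner ℝ ξ x = inner ℝ η x + inner ℝ (ξ - η) x := by rw [inner_sub_left]; ring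
    have h2 : inner ℝ (ξ - η) x ≤ dist K 0 * dist ξ η := by
      rw [dist_eq_norm ξ η, mul_comm]
      exact (real_inner_le_norm _ _).trans (by gcongr; exact norm_le_dist_zero hx)
    rw [h1]
    exact add_le_add (inner_le_supp η hx) h2
  refine (LipschitzWith.of_dist_le_mul (K := (dist K 0).toNNReal) fun ξ η => ?_).continuous
  rw [Real.coe_toNNReal _ dist_nonneg, Real.dist_eq, abs_le]
  have := key η ξ
  rw [dist_comm η ξ] at this
  exact ⟨by linarith, by linarith [key ξ η]⟩

/-- A point outside K is strictly separated from K by a functional, which the Riesz representation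
turns into a vector ξ violating the hypothesis. -/
lemma mem_of_forall_inner_le_supp [CompleteSpace E] {K : ConvexBody E} {x : E}
    (h : ∀ ξ, inner ℝ ξ x ≤ supp K ξ) : x ∈ K := by
  by_contra hx
  obtain ⟨f, u, hf, hu⟩ := geometric_hahn_banach_closed_point K.convex K.isClosed hx
  let ξ := (InnerProductSpace.toDual ℝ E).symm f
  have hξ : ∀ y, inner ℝ ξ y = f y := fun y => InnerProductSpace.toDual_symm_apply
  obtain ⟨y, hy, hy'⟩ := exists_inner_eq_supp K ξ
  have := h ξ
  rw [← hy', hξ, hξ] at this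
  linarith [hf y hy]

lemma mem_iff_forall_inner_le_supp [CompleteSpace E] {K : ConvexBody E} {x : E} :
    x ∈ K ↔ ∀ ξ, inner ℝ ξ x ≤ supp K ξ :=
  ⟨fun hx ξ => inner_le_supp ξ hx, mem_of_forall_inner_le_supp⟩

/-- Both sides are continuous in ξ. Having only countably many conditions is what the measurable
selection below needs. -/
lemma mem_of_forall_denseSeq_inner_le_supp [CompleteSpace E]
    [TopologicalSpace.SeparableSpace E] {K : ConvexBody E} {x : E}
    (h : ∀ n, inner ℝ (TopologicalSpace.denseSeq E n) x ≤ supp K (TopologicalSpace.denseSeq E n)) :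
    x ∈ K := by
  refine mem_of_forall_inner_le_supp fun ξ => ?_
  have hcl : IsClosed {ξ : E | inner ℝ ξ x ≤ supp K ξ} :=
    isClosed_le (by fun_prop) (continuous_supp K)
  have := (TopologicalSpace.denseRange_denseSeq E).induction_on
    (p := fun ξ => inner ℝ ξ x ≤ supp K ξ) ξ hcl h
  exact this

lemma convexBody_ext_supp [CompleteSpace E] {K L : ConvexBody E} (h : ∀ ξ, supp K ξ = supp L ξ) :
    K = L := by
  refine SetLike.ext fun x => ?_
  simp only [mem_iff_forall_inner_le_supp, h]

end Support

/-! ### Riesz variation and absolute continuity. -/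

section RieszVariation

variable {M : Type*}

/-- The partition of `[a, c]` obtained from a partition of `[a, b]` by adding the interval
`[b, c]`. -/
def IntervalPartition.append {a b : ℝ} (P : IntervalPartition a b) {c : ℝ} (hc : b < c) :
    IntervalPartition a c where
  n := P.n + 1
  pt i := if i ≤ P.n then P.pt i else c
  pt_zero := by simp [P.pt_zero]
  pt_last := by simp
  pt_lt i hi := by
    rcases Nat.lt_succ_iff_lt_or_eq.1 hi with h | h
    · simpa [h.le, Nat.succ_le_of_lt h] using P.pt_lt i h
    · subst h
      simpa [P.pt_last] using hc

lemma IntervalPartition.pt_le_pt {a b : ℝ} (P : IntervalPartition a b) {i j : ℕ} (hij : i ≤ j)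
    (hj : j ≤ P.n) : P.pt i ≤ P.pt j := by
  induction j, hij using Nat.le_induction with
  | base => exact le_rfl
  | succ k hk ih => exact (ih (by omega)).trans (P.pt_lt k (by omega)).le

lemma IntervalPartition.pt_mem {a b : ℝ} (P : IntervalPartition a b) {i : ℕ} (hi : i ≤ P.n) :
    P.pt i ∈ Icc a b := by
  have h₀ := P.pt_le_pt (Nat.zero_le i) hi
  have h₁ := P.pt_le_pt hi le_rfl
  rw [P.pt_zero] at h₀
  rw [P.pt_last] at h₁
  exact ⟨h₀, h₁⟩

lemma exists_intervalPartition_mesh_lt {a b : ℝ} (hab : a ≤ b) {δ : ℝ} (hδ : 0 < δ) :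
    ∃ P : IntervalPartition a b, ∀ i < P.n, P.pt (i + 1) - P.pt i < δ := by
  rcases hab.eq_or_lt with rfl | hab
  · exact ⟨⟨0, fun _ => a, rfl, rfl, by simp⟩, by simp⟩
  obtain ⟨n, hn⟩ := exists_nat_gt ((b - a) / δ)
  have hn0 : (0 : ℝ) < n := (div_pos (sub_pos.2 hab) hδ).trans hn
  have hstep : ∀ i : ℕ, (a + (↑(i + 1) : ℝ) * ((b - a) / n)) - (a + (i : ℝ) * ((b - a) / n)) =
      (b - a) / n := by
    intro i
    push_cast
    ring
  refine ⟨⟨n, fun i => a + i * ((b - a) / n), by simp, by field_simp; ring, fun i _ => ?_⟩,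
    fun i _ => ?_⟩
  · have := hstep i
    have : 0 < (b - a) / n := div_pos (sub_pos.2 hab) hn0
    linarith
  · simp only [hstep]
    rw [div_lt_iff₀ hδ] at hn
    rwa [div_lt_iff₀ hn0, mul_comm]

lemma rieszVar_add_le [PseudoEMetricSpace M] (p : ℝ) (f : ℝ → M) {a b c : ℝ} (hab : a ≤ b)
    (hc : b < c) :
    rieszVar p f a b + edist (f b) (f c) ^ p / ENNReal.ofReal ((c - b) ^ (p - 1)) ≤
      rieszVar p f a c := by
  obtain ⟨P₀, -⟩ := exists_intervalPartition_mesh_lt hab one_pos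
  have : Nonempty (IntervalPartition a b) := ⟨P₀⟩
  rw [rieszVar, ENNReal.iSup_add]
  refine iSup_le fun P => ?_
  refine le_trans (le_of_eq ?_) (le_iSup _ (P.append hc))
  simp only [IntervalPartition.append]
  rw [Finset.sum_range_succ]
  congr 1
  · refine Finset.sum_congr rfl fun i hi => ?_
    have hi := Finset.mem_range.1 hi
    simp [hi.le, Nat.succ_le_of_lt hi]
  · simp [P.pt_last]

lemma rieszVar_mono [PseudoEMetricSpace M] (p : ℝ) (f : ℝ → M) {a b c : ℝ} (hab : a ≤ b)
    (hc : b ≤ c) : rieszVar p f a b ≤ rieszVar p f a c := by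
  rcases hc.eq_or_lt with rfl | hc
  · exact le_rfl
  · exact le_self_add.trans (rieszVar_add_le p f hab hc)

/-- V(t) is the Riesz variation on [0, t]; the estimate is its superadditivity under appending one
interval. -/
lemma MemBV.exists_monotone_control [PseudoMetricSpace M] {p T : ℝ} {f : ℝ → M}
    (hf : MemBV p T f) : ∃ V : ℝ → ℝ, MonotoneOn V (Icc 0 T) ∧
      ∀ a b, 0 ≤ a → a < b → b ≤ T → dist (f a) (f b) ^ p ≤ (V b - V a) * (b - a) ^ (p - 1) := by
  have hfin : ∀ t, 0 ≤ t → t ≤ T → rieszVar p f 0 t ≠ ⊤ := fun t h0 h1 =>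
    ((rieszVar_mono p f h0 h1).trans_lt hf).ne
  refine ⟨fun t => (rieszVar p f 0 t).toReal, fun a ha b hb hab =>
    ENNReal.toReal_mono (hfin b hb.1 hb.2) (rieszVar_mono p f ha.1 hab), fun a b h0 hab hbT => ?_⟩
  have h := rieszVar_add_le p f h0 hab
  have hpos : 0 < (b - a) ^ (p - 1) := Real.rpow_pos_of_pos (sub_pos.2 hab) _
  set q := edist (f a) (f b) ^ p / ENNReal.ofReal ((b - a) ^ (p - 1)) with hq
  have hb := hfin b (h0.trans hab.le) hbT
  have hqtop : q ≠ ⊤ := ne_top_of_le_ne_top hb (le_add_self.trans h)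
  have h' := ENNReal.toReal_mono hb h
  rw [ENNReal.toReal_add (hfin a h0 (hab.le.trans hbT)) hqtop] at h'
  have hq' : q.toReal = dist (f a) (f b) ^ p / (b - a) ^ (p - 1) := by
    rw [hq, ENNReal.toReal_div, ← ENNReal.toReal_rpow, ENNReal.toReal_ofReal hpos.le, edist_dist,
      ENNReal.toReal_ofReal dist_nonneg]
  rw [hq'] at h'
  rw [← div_le_iff₀ hpos]
  linarith

/-- The constant C satisfies C ^ (p - 1) = ε⁻¹. Either x ≤ C * l, or x ^ (p - 1) exceeds ε⁻¹ * l ^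
(p - 1) and dividing the hypothesis by it leaves x ≤ ε * v. -/
lemma le_mul_add_mul_of_rpow_le {p : ℝ} (hp : 1 < p) {ε : ℝ} (hε : 0 < ε) {x l v : ℝ}
    (hl : 0 < l) (hv : 0 ≤ v) (h : x ^ p ≤ v * l ^ (p - 1)) :
    x ≤ ε * v + ε⁻¹ ^ (p - 1)⁻¹ * l := by
  have hp1 : 0 < p - 1 := sub_pos.2 hp
  set C := ε⁻¹ ^ (p - 1)⁻¹ with hC
  have hC0 : 0 < C := Real.rpow_pos_of_pos (inv_pos.2 hε) _
  by_cases hxl : x ≤ C * l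
  · nlinarith [mul_nonneg hε.le hv]
  · push Not at hxl
    have hx0 : 0 < x := (mul_pos hC0 hl).trans hxl
    have h1 : ε⁻¹ * l ^ (p - 1) ≤ x ^ (p - 1) := by
      calc ε⁻¹ * l ^ (p - 1) = (C * l) ^ (p - 1) := by
            rw [Real.mul_rpow hC0.le hl.le, hC, ← Real.rpow_mul (inv_pos.2 hε).le,
              inv_mul_cancel₀ hp1.ne', Real.rpow_one]
        _ ≤ x ^ (p - 1) := Real.rpow_le_rpow (by positivity) hxl.le hp1.le
    have h2 : x ^ p = x ^ (p - 1) * x := by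
      rw [← Real.rpow_add_one hx0.ne']; congr 1; ring
    have hlp : 0 < l ^ (p - 1) := Real.rpow_pos_of_pos hl _
    have h3 : ε⁻¹ * x * l ^ (p - 1) ≤ v * l ^ (p - 1) := by
      calc ε⁻¹ * x * l ^ (p - 1) = ε⁻¹ * l ^ (p - 1) * x := by ring
        _ ≤ x ^ (p - 1) * x := by gcongr
        _ ≤ v * l ^ (p - 1) := by rw [← h2]; exact h
    have h4 : ε⁻¹ * x ≤ v := le_of_mul_le_mul_right h3 hlp
    have h5 : x ≤ ε * v := by rwa [inv_mul_le_iff₀ hε] at h4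
    have : 0 ≤ C * l := by positivity
    linarith

/-- Induction on the interval with the largest right end: by disjointness all the others end before
it starts, and the increments telescope up to nonnegative gaps. -/
lemma sum_sub_le_of_monotoneOn_of_disjoint {V : ℝ → ℝ} {T : ℝ} (hV : MonotoneOn V (Icc 0 T))
    {a b : ℕ → ℝ} (s : Finset ℕ) (h0 : ∀ i ∈ s, 0 ≤ a i) (hab : ∀ i ∈ s, a i < b i)
    (hdisj : (s : Set ℕ).PairwiseDisjoint fun i => Ioc (a i) (b i)) :
    ∀ u ∈ Icc 0 T, (∀ i ∈ s, b i ≤ u) → ∑ i ∈ s, (V (b i) - V (a i)) ≤ V u - V 0 := by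
  induction s using Finset.induction_on_max_value b with
  | empty =>
    intro u hu _
    simpa using hV ⟨le_rfl, hu.1.trans hu.2⟩ hu hu.1
  | insert k s hk hmax ih =>
    intro u hu hbu
    have hka := h0 k (Finset.mem_insert_self _ _)
    have hkb := (hab k (Finset.mem_insert_self _ _)).le
    have hku := hbu k (Finset.mem_insert_self _ _)
    have hak : a k ∈ Icc 0 T := ⟨hka, (hkb.trans hku).trans hu.2⟩
    have hbk : b k ∈ Icc 0 T := ⟨hka.trans hkb, hku.trans hu.2⟩
    have hle : ∀ i ∈ s, b i ≤ a k := by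
      intro i hi
      by_contra! hcon
      have hd := hdisj (Finset.mem_coe.2 (Finset.mem_insert_of_mem hi))
        (Finset.mem_coe.2 (Finset.mem_insert_self k s)) (fun h => hk (h ▸ hi))
      exact Set.disjoint_left.1 hd
        (show b i ∈ Ioc (a i) (b i) from ⟨hab i (Finset.mem_insert_of_mem hi), le_rfl⟩)
        ⟨hcon, hmax i hi⟩
    have := ih (fun i hi => h0 i (Finset.mem_insert_of_mem hi))
      (fun i hi => hab i (Finset.mem_insert_of_mem hi)) (hdisj.subset (by simp)) (a k) hak hle
    rw [Finset.sum_insert hk]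
    linarith [hV hbk hu hku]

/-- Each increment is at most η times an increment of V plus C times a length. The first terms sum
to at most η * W whatever the intervals are; the second are small with the total length. -/
lemma MemBV.absolutelyContinuousOnInterval [PseudoMetricSpace M] {p T : ℝ} (hp : 1 < p)
    (hT : 0 ≤ T) {f : ℝ → M} (hf : MemBV p T f) : AbsolutelyContinuousOnInterval f 0 T := by
  obtain ⟨V, hV, hVf⟩ := hf.exists_monotone_control
  rw [absolutelyContinuousOnInterval_iff]
  intro ε hε
  have hW : 0 ≤ V T - V 0 := sub_nonneg.2 (hV ⟨le_rfl, hT⟩ ⟨hT, le_rfl⟩ hT)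
  set W := V T - V 0
  set η := ε / (2 * (W + 1)) with hη_def
  have hη : 0 < η := by positivity
  set C := η⁻¹ ^ (p - 1)⁻¹ with hC_def
  have hC : 0 < C := Real.rpow_pos_of_pos (inv_pos.2 hη) _
  refine ⟨ε / (2 * C), by positivity, ?_⟩
  rintro ⟨n, I⟩ ⟨hI, hdisj⟩ hlen
  simp only [uIcc_of_le hT] at hI hdisj hlen ⊢
  set a : ℕ → ℝ := fun i => min (I i).1 (I i).2
  set b : ℕ → ℝ := fun i => max (I i).1 (I i).2
  -- Degenerate intervals have zero increment and are dropped, since the control by V requires a <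
  -- b.
  set s := (Finset.range n).filter fun i => (I i).1 ≠ (I i).2 with hs
  have hsn : ∀ i ∈ s, i ∈ Finset.range n := fun i hi => (Finset.mem_filter.1 hi).1
  have hab : ∀ i ∈ s, a i < b i := fun i hi => min_lt_max.2 (Finset.mem_filter.1 hi).2
  have ha0 : ∀ i ∈ s, 0 ≤ a i := fun i hi =>
    le_min (hI i (hsn i hi)).1.1 (hI i (hsn i hi)).2.1
  have hbT : ∀ i ∈ s, b i ≤ T := fun i hi =>
    max_le (hI i (hsn i hi)).1.2 (hI i (hsn i hi)).2.2
  have hsum := sum_sub_le_of_monotoneOn_of_disjoint hV s ha0 hab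
    (hdisj.subset fun i hi => hsn i hi) T ⟨hT, le_rfl⟩ hbT
  have hdist : ∀ i, dist (f (I i).1) (f (I i).2) = dist (f (a i)) (f (b i)) := by
    intro i
    rcases le_total (I i).1 (I i).2 with h | h
    · simp [a, b, h]
    · simp [a, b, h, dist_comm]
  have hterm : ∀ i ∈ s, dist (f (I i).1) (f (I i).2) ≤
      η * (V (b i) - V (a i)) + C * dist (I i).1 (I i).2 := by
    intro i hi
    have hl : dist (I i).1 (I i).2 = b i - a i := by
      rw [Real.dist_eq, max_sub_min_eq_abs']
    rw [hdist, hl]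
    refine le_mul_add_mul_of_rpow_le hp hη (sub_pos.2 (hab i hi)) ?_
      (hVf _ _ (ha0 i hi) (hab i hi) (hbT i hi))
    exact sub_nonneg.2 (hV ⟨ha0 i hi, (hab i hi).le.trans (hbT i hi)⟩
      ⟨(ha0 i hi).trans (hab i hi).le, hbT i hi⟩ (hab i hi).le)
  calc ∑ i ∈ Finset.range n, dist (f (I i).1) (f (I i).2)
      = ∑ i ∈ s, dist (f (I i).1) (f (I i).2) := by
        refine (Finset.sum_subset (fun i hi => hsn i hi) fun i hi his => ?_).symm
        have : (I i).1 = (I i).2 := by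
          by_contra hne
          exact his (Finset.mem_filter.2 ⟨hi, hne⟩)
        simp [this]
    _ ≤ ∑ i ∈ s, (η * (V (b i) - V (a i)) + C * dist (I i).1 (I i).2) := Finset.sum_le_sum hterm
    _ = η * ∑ i ∈ s, (V (b i) - V (a i)) + C * ∑ i ∈ s, dist (I i).1 (I i).2 := by
        rw [Finset.sum_add_distrib, Finset.mul_sum, Finset.mul_sum]
    _ ≤ η * W + C * ∑ i ∈ Finset.range n, dist (I i).1 (I i).2 := by
        gcongr
        exact fun i hi => hsn i hi
    _ < η * W + C * (ε / (2 * C)) := by gcongr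
    _ ≤ ε := by
        have h1 : C * (ε / (2 * C)) = ε / 2 := by field_simp
        have h2 : η * (W + 1) = ε / 2 := by rw [hη_def]; field_simp
        nlinarith

lemma MemBV.of_edist_le_add {M₁ M₂ : Type*} [PseudoEMetricSpace M] [PseudoEMetricSpace M₁]
    [PseudoEMetricSpace M₂] {p T : ℝ} (hp : 1 < p) {f : ℝ → M} {f₁ : ℝ → M₁} {f₂ : ℝ → M₂}
    (h₁ : MemBV p T f₁) (h₂ : MemBV p T f₂)
    (h : ∀ s t, edist (f s) (f t) ≤ edist (f₁ s) (f₁ t) + edist (f₂ s) (f₂ t)) :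
    MemBV p T f := by
  refine lt_of_le_of_lt (b := 2 ^ (p - 1) * (rieszVar p f₁ 0 T + rieszVar p f₂ 0 T)) ?_
    (ENNReal.mul_lt_top (ENNReal.rpow_lt_top_of_nonneg (by linarith) (by simp))
      (ENNReal.add_lt_top.2 ⟨h₁, h₂⟩))
  refine iSup_le fun P => ?_
  calc _ ≤ ∑ i ∈ Finset.range P.n, 2 ^ (p - 1) *
        (edist (f₁ (P.pt i)) (f₁ (P.pt (i + 1))) ^ p /
            ENNReal.ofReal ((P.pt (i + 1) - P.pt i) ^ (p - 1)) +
          edist (f₂ (P.pt i)) (f₂ (P.pt (i + 1))) ^ p /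
            ENNReal.ofReal ((P.pt (i + 1) - P.pt i) ^ (p - 1))) := by
        refine Finset.sum_le_sum fun i _ => ?_
        rw [← ENNReal.add_div, ← mul_div_assoc]
        gcongr
        exact (ENNReal.rpow_le_rpow (h _ _) (by linarith)).trans
          (ENNReal.rpow_add_le_mul_rpow_add_rpow _ _ hp.le)
    _ ≤ _ := by
        rw [← Finset.mul_sum, Finset.sum_add_distrib]
        gcongr
        · exact le_iSup (fun P : IntervalPartition 0 T => ∑ i ∈ Finset.range P.n,
            edist (f₁ (P.pt i)) (f₁ (P.pt (i + 1))) ^ p /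
              ENNReal.ofReal ((P.pt (i + 1) - P.pt i) ^ (p - 1))) P
        · exact le_iSup (fun P : IntervalPartition 0 T => ∑ i ∈ Finset.range P.n,
            edist (f₂ (P.pt i)) (f₂ (P.pt (i + 1))) ^ p /
              ENNReal.ofReal ((P.pt (i + 1) - P.pt i) ^ (p - 1))) P

end RieszVariation

/-! ### Selections as primitives of their derivatives. -/

section FundamentalTheorem

variable {E : Type*} [NormedAddCommGroup E] [InnerProductSpace ℝ E]

lemma MemBV.ae_differentiableAt [FiniteDimensional ℝ E] {p T : ℝ} (hp : 1 < p) (hT : 0 ≤ T)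
    {f : ℝ → E} (hf : MemBV p T f) : ∀ᵐ t ∂(volume.restrict (Icc 0 T)), DifferentiableAt ℝ f t := by
  have hac := hf.absolutelyContinuousOnInterval hp hT
  have := hac.boundedVariationOn.ae_differentiableAt_of_mem_uIcc
  rw [uIcc_of_le hT] at this
  rwa [ae_restrict_iff' measurableSet_Icc]

lemma absolutelyContinuousOnInterval_comp_lipschitzWith {M N : Type*} [PseudoMetricSpace M]
    [PseudoMetricSpace N] {u : M → N} {K : ℝ≥0} (hu : LipschitzWith K u) {f : ℝ → M} {a b : ℝ}
    (hf : AbsolutelyContinuousOnInterval f a b) :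
    AbsolutelyContinuousOnInterval (fun t => u (f t)) a b := by
  have := Filter.Tendsto.const_mul (K : ℝ) hf
  rw [mul_zero] at this
  refine squeeze_zero (fun _ => Finset.sum_nonneg fun _ _ => dist_nonneg) (fun I => ?_) this
  rw [Finset.mul_sum]
  exact Finset.sum_le_sum fun i _ => hu.dist_le_mul _ _

/-- Integrability on the subintervals of `[0, T]`. -/
lemma intervalIntegrable_of_memLp {p T : ℝ} (hp : 1 < p) {F : Type*} [NormedAddCommGroup F]
    {φ : ℝ → F} (hφ : MemLp φ (ENNReal.ofReal p) (volume.restrict (Icc 0 T))) {a b : ℝ}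
    (ha : a ∈ Icc 0 T) (hb : b ∈ Icc 0 T) : IntervalIntegrable φ volume a b := by
  have h1 : Integrable φ (volume.restrict (Icc 0 T)) :=
    hφ.integrable (by simpa using ENNReal.ofReal_le_ofReal hp.le)
  exact (intervalIntegrable_iff.2 (IntegrableOn.mono_set h1
    (uIoc_subset_uIcc.trans (uIcc_subset_Icc ha hb))))

/-- The scalar theorem for absolutely continuous functions is applied to t ↦ ⟪ξ, f t⟫ for every ξ.
-/
lemma MemBV.integral_deriv_eq_sub [FiniteDimensional ℝ E] {p T : ℝ} (hp : 1 < p) {f : ℝ → E}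
    (hf : MemBV p T f) (hf' : MemLp (deriv f) (ENNReal.ofReal p) (volume.restrict (Icc 0 T)))
    {a b : ℝ} (ha : a ∈ Icc 0 T) (hb : b ∈ Icc 0 T) :
    ∫ t in a..b, deriv f t = f b - f a := by
  have hT : 0 ≤ T := ha.1.trans ha.2
  have hInt := intervalIntegrable_of_memLp hp hf' ha hb
  refine ext_inner_left ℝ fun ξ => ?_
  have hsub : uIcc a b ⊆ uIcc 0 T := by rw [uIcc_of_le hT]; exact uIcc_subset_Icc ha hb
  have hac : ∫ t in a..b, deriv (fun t => inner ℝ ξ (f t)) t = inner ℝ ξ (f b) - inner ℝ ξ (f a) :=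
    ((absolutelyContinuousOnInterval_comp_lipschitzWith (innerSL ℝ ξ).lipschitz
      (hf.absolutelyContinuousOnInterval hp hT)).mono hsub).integral_deriv_eq_sub
  rw [inner_sub_right, ← hac, ← innerSL_apply_apply ℝ ξ,
    ← ContinuousLinearMap.intervalIntegral_comp_comm _ hInt]
  refine intervalIntegral.integral_congr_ae ?_
  have hd := hf.ae_differentiableAt hp hT
  rw [ae_restrict_iff' measurableSet_Icc] at hd
  filter_upwards [hd] with t ht hab
  have htd := (ht (uIcc_subset_Icc ha hb (uIoc_subset_uIcc hab))).hasDerivAt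
  exact (((innerSL ℝ ξ).hasFDerivAt.comp_hasDerivAt t htd).deriv).symm

/-- Hölder's inequality: the factor (b - a) ^ (1 - 1 / p), raised to the power p, is exactly the
Riesz denominator. -/
lemma enorm_intervalIntegral_rpow_le {p : ℝ} (hp : 1 < p) {a b : ℝ} (hab : a < b) {φ : ℝ → E}
    (hφ : AEStronglyMeasurable φ (volume.restrict (Ioc a b))) :
    ‖∫ t in a..b, φ t‖ₑ ^ p / ENNReal.ofReal ((b - a) ^ (p - 1)) ≤
      ∫⁻ t in Ioc a b, ‖φ t‖ₑ ^ p := by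
  have hp0 : 0 < p := by linarith
  have hpos : 0 < b - a := sub_pos.2 hab
  have h1 : ‖∫ t in a..b, φ t‖ₑ ≤ eLpNorm φ 1 (volume.restrict (Ioc a b)) := by
    rw [intervalIntegral.integral_of_le hab.le, eLpNorm_one_eq_lintegral_enorm]
    exact enorm_integral_le_lintegral_enorm _
  have h2 := eLpNorm_le_eLpNorm_mul_rpow_measure_univ (p := 1) (q := ENNReal.ofReal p)
    (by simpa using ENNReal.ofReal_le_ofReal hp.le) hφ
  have h3 : eLpNorm φ (ENNReal.ofReal p) (volume.restrict (Ioc a b)) ^ p =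
      ∫⁻ t in Ioc a b, ‖φ t‖ₑ ^ p := by
    rw [eLpNorm_eq_eLpNorm' (by simpa using hp0) (by simp), ENNReal.toReal_ofReal hp0.le,
      lintegral_rpow_enorm_eq_rpow_eLpNorm' hp0]
  apply ENNReal.div_le_of_le_mul
  calc ‖∫ t in a..b, φ t‖ₑ ^ p ≤ (eLpNorm φ (ENNReal.ofReal p) (volume.restrict (Ioc a b)) *
        ENNReal.ofReal (b - a) ^ (1 - 1 / p)) ^ p := by
        refine ENNReal.rpow_le_rpow (h1.trans (h2.trans (le_of_eq ?_))) hp0.le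
        simp [ENNReal.toReal_ofReal hp0.le]
    _ = _ := by
        rw [ENNReal.mul_rpow_of_nonneg _ _ hp0.le, h3, ← ENNReal.rpow_mul,
          ← ENNReal.ofReal_rpow_of_pos hpos]
        congr 2
        field_simp

lemma MemBV.const_add_integral {p T : ℝ} (hp : 1 < p) {φ : ℝ → E}
    (hφ : MemLp φ (ENNReal.ofReal p) (volume.restrict (Icc 0 T))) (x : E) :
    MemBV p T fun t => x + ∫ s in (0 : ℝ)..t, φ s := by
  have hp0 : 0 < p := by linarith
  have hfin : ∫⁻ t in Icc 0 T, ‖φ t‖ₑ ^ p < ⊤ := by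
    have := lintegral_rpow_enorm_lt_top_of_eLpNorm_lt_top (by simpa using hp0) (by simp) hφ.2
    rwa [ENNReal.toReal_ofReal hp0.le] at this
  refine lt_of_le_of_lt (iSup_le fun P => ?_) hfin
  calc _ ≤ ∑ i ∈ Finset.range P.n, ∫⁻ t in Ioc (P.pt i) (P.pt (i + 1)), ‖φ t‖ₑ ^ p := by
        refine Finset.sum_le_sum fun i hi => ?_
        have hi := Finset.mem_range.1 hi
        have hi0 := P.pt_mem hi.le
        have hi1 := P.pt_mem (Nat.succ_le_of_lt hi)
        have h00 : (0 : ℝ) ∈ Icc 0 T := ⟨le_rfl, hi0.1.trans hi0.2⟩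
        refine le_trans (le_of_eq ?_) (enorm_intervalIntegral_rpow_le hp (P.pt_lt i hi)
          (hφ.1.mono_measure (Measure.restrict_mono
            (Ioc_subset_Icc_self.trans (Icc_subset_Icc hi0.1 hi1.2)) le_rfl)))
        rw [edist_comm, edist_eq_enorm_sub, add_sub_add_left_eq_sub,
          intervalIntegral.integral_interval_sub_left
            (intervalIntegrable_of_memLp hp hφ h00 hi1)
            (intervalIntegrable_of_memLp hp hφ h00 hi0)]
    _ ≤ ∫⁻ t in Icc 0 T, ‖φ t‖ₑ ^ p := by
        have key : ∀ k ≤ P.n, ∑ i ∈ Finset.range k,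
            ∫⁻ t in Ioc (P.pt i) (P.pt (i + 1)), ‖φ t‖ₑ ^ p =
            ∫⁻ t in Ioc (P.pt 0) (P.pt k), ‖φ t‖ₑ ^ p := by
          intro k
          induction k with
          | zero => simp
          | succ k ih =>
            intro hk
            rw [Finset.sum_range_succ, ih (by omega), ← lintegral_union measurableSet_Ioc
              (Ioc_disjoint_Ioc_of_le le_rfl),
              Ioc_union_Ioc_eq_Ioc (P.pt_le_pt (Nat.zero_le k) (by omega))
                (P.pt_lt k (by omega)).le]
        rw [key P.n le_rfl, P.pt_zero, P.pt_last]
        exact lintegral_mono_set Ioc_subset_Icc_self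

end FundamentalTheorem

/-! ### Measurable selection by the point of least norm. -/

section MeasurableSelection

variable {Ω E : Type*} [MeasurableSpace Ω] [NormedAddCommGroup E]

/-- Solvability is rewritten with countable operations: for each n some point of a dense sequence
satisfies the norm bound and the first n constraints up to 1 / (n + 1). Such approximate solutions
stay in a compact ball, and any limit point is an exact solution. -/
lemma measurableSet_exists_forall_le [ProperSpace E] {c : ℕ → Ω → E → ℝ}
    (hm : ∀ j x, Measurable fun ω => c j ω x)
    (hc : ∀ j ω, Continuous (c j ω)) {R : Ω → ℝ} (hR : Measurable R) :
    MeasurableSet {ω | ∃ x, ‖x‖ ≤ R ω ∧ ∀ j, c j ω x ≤ 0} := by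
  set q := TopologicalSpace.denseSeq E
  have hpos : ∀ n : ℕ, (0 : ℝ) < 1 / (n + 1) := fun n => Nat.one_div_pos_of_nat
  have key : {ω | ∃ x, ‖x‖ ≤ R ω ∧ ∀ j, c j ω x ≤ 0} =
      ⋂ n : ℕ, ⋃ k : ℕ, ({ω | ‖q k‖ < R ω + 1 / (n + 1)} ∩
        ⋂ j ∈ Finset.range n, {ω | c j ω (q k) < 1 / (n + 1)}) := by
    ext ω
    simp only [mem_ofPred_eq, mem_iInter, mem_iUnion, mem_inter_iff]
    constructor
    · rintro ⟨x, hx, hxc⟩ n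
      have hopen : IsOpen ({y : E | ‖y‖ < R ω + 1 / (n + 1)} ∩
          ⋂ j ∈ Finset.range n, {y | c j ω y < 1 / (n + 1)}) :=
        (isOpen_lt continuous_norm continuous_const).inter
          (isOpen_biInter_finset fun j _ => isOpen_lt (hc j ω) continuous_const)
      obtain ⟨k, hk⟩ := (TopologicalSpace.denseRange_denseSeq E).exists_mem_open hopen
        ⟨x, by simp only [mem_ofPred_eq]; linarith [hpos n], by
          simp only [mem_iInter, mem_ofPred_eq]
          exact fun j _ => (hxc j).trans_lt (hpos n)⟩
      exact ⟨k, by simpa only [mem_inter_iff, mem_iInter, mem_ofPred_eq] using hk⟩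
    · intro h
      choose k hk hkc using h
      have hball : ∀ n, q (k n) ∈ Metric.closedBall (0 : E) (R ω + 1) := by
        intro n
        rw [mem_closedBall_zero_iff]
        refine (hk n).le.trans (add_le_add le_rfl ?_)
        rw [div_le_one (by positivity)]
        linarith [n.cast_nonneg (α := ℝ)]
      obtain ⟨x, -, ψ, hψ, hlim⟩ :=
        (isCompact_closedBall (0 : E) (R ω + 1)).tendsto_subseq hball
      have h0 : Tendsto (fun n : ℕ => (1 : ℝ) / ((ψ n : ℝ) + 1)) atTop (𝓝 0) :=
        tendsto_one_div_add_atTop_nhds_zero_nat.comp hψ.tendsto_atTop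
      refine ⟨x, ?_, fun j => ?_⟩
      · refine le_of_tendsto_of_tendsto' hlim.norm (by simpa using h0.const_add (R ω))
          fun n => (hk (ψ n)).le
      · refine le_of_tendsto_of_tendsto (((hc j ω).tendsto x).comp hlim) h0 ?_
        filter_upwards [hψ.tendsto_atTop.eventually_gt_atTop j] with n hn
        exact (hkc (ψ n) j (Finset.mem_range.2 hn)).le
  rw [key]
  refine MeasurableSet.iInter fun n => MeasurableSet.iUnion fun k => ?_
  refine (measurableSet_lt measurable_const (hR.add_const _)).inter ?_
  exact Finset.measurableSet_biInter _ fun j _ => measurableSet_lt (hm j _) measurable_const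

/-- Countably many constraints `c j ω x ≤ 0`, measurable in `ω` and continuous in `x`, with a
nonempty convex set of solutions for every `ω`, have a measurable solution. -/
theorem exists_measurable_forall_le [InnerProductSpace ℝ E] [FiniteDimensional ℝ E]
    [MeasurableSpace E] [BorelSpace E] {c : ℕ → Ω → E → ℝ}
    (hm : ∀ j x, Measurable fun ω => c j ω x)
    (hc : ∀ j ω, Continuous (c j ω)) (hconv : ∀ ω, Convex ℝ {x | ∀ j, c j ω x ≤ 0})
    (hne : ∀ ω, ∃ x, ∀ j, c j ω x ≤ 0) :
    ∃ φ : Ω → E, Measurable φ ∧ ∀ ω j, c j ω (φ ω) ≤ 0 := by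
  have : ProperSpace E := FiniteDimensional.proper ℝ E
  have hmin : ∀ ω, ∃ x, (∀ j, c j ω x ≤ 0) ∧ (∀ y, (∀ j, c j ω y ≤ 0) → ‖x‖ ≤ ‖y‖) ∧
      ∀ y, (∀ j, c j ω y ≤ 0) → ‖y‖ ≤ ‖x‖ → y = x := by
    intro ω
    have hcl : IsClosed {x | ∀ j, c j ω x ≤ 0} := by
      simp only [ofPred_forall]
      exact isClosed_iInter fun j => isClosed_le (hc j ω) continuous_const
    have hne' : {x | ∀ j, c j ω x ≤ 0}.Nonempty := hne ω
    obtain ⟨x, hx, hx'⟩ := exists_norm_eq_iInf_of_complete_convex hne'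
      hcl.isComplete (hconv ω) 0
    rw [norm_eq_iInf_iff_real_inner_le_zero (hconv ω) hx] at hx'
    -- The variational inequality for the projection of 0 gives minimality of ‖x‖ and uniqueness of
    -- the minimizer at once.
    have h1 : ∀ y, (∀ j, c j ω y ≤ 0) → ‖y - x‖ ^ 2 ≤ ‖y‖ ^ 2 - ‖x‖ ^ 2 := by
      intro y hy
      have h := hx' y hy
      rw [zero_sub, inner_neg_left, inner_sub_right, real_inner_self_eq_norm_sq] at h
      rw [norm_sub_sq_real, real_inner_comm]
      linarith
    refine ⟨x, hx, fun y hy => ?_, fun y hy hyx => ?_⟩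
    · have := h1 y hy
      nlinarith [sq_nonneg ‖y - x‖, norm_nonneg x, norm_nonneg y]
    · have := h1 y hy
      have h2 : ‖y - x‖ ^ 2 = 0 := by nlinarith [sq_nonneg ‖y - x‖, norm_nonneg x, norm_nonneg y]
      simpa [sub_eq_zero] using h2
  choose φ hφ hφmin hφuniq using hmin
  have hnorm : Measurable fun ω => ‖φ ω‖ := by
    refine measurable_of_Iic fun r => ?_
    convert measurableSet_exists_forall_le hm hc (measurable_const (a := r)) using 1
    ext ω
    exact ⟨fun h => ⟨φ ω, h, hφ ω⟩, fun ⟨x, hx, hxc⟩ => (hφmin ω x hxc).trans hx⟩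
  have hinner : ∀ ξ : E, Measurable fun ω => inner ℝ ξ (φ ω) := by
    intro ξ
    refine measurable_of_Iic fun r => ?_
    -- Within the ball of radius ‖φ ω‖ the only solution is φ ω. Prepending the constraint ⟪ξ, x⟫ ≤
    -- r as number 0 therefore makes solvability equivalent to ⟪ξ, φ ω⟫ ≤ r.
    have := measurableSet_exists_forall_le (R := fun ω => ‖φ ω‖)
      (c := fun j => Nat.casesOn j (fun _ x => inner ℝ ξ x - r) c)
      (fun j x => by cases j; exacts [measurable_const, hm _ x])
      (fun j ω => by cases j; exacts [by fun_prop, hc _ ω]) hnorm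
    convert this using 1
    ext ω
    constructor
    · refine fun h => ⟨φ ω, le_rfl, fun j => ?_⟩
      cases j
      exacts [sub_nonpos.2 h, hφ ω _]
    · rintro ⟨x, hx, hxc⟩
      rw [hφuniq ω x (fun j => hxc (j + 1)) hx] at hxc
      exact sub_nonpos.1 (hxc 0)
  refine ⟨φ, ?_, hφ⟩
  have hsum : φ = fun ω => ∑ i, (inner ℝ (stdOrthonormalBasis ℝ E i) (φ ω)) •
      stdOrthonormalBasis ℝ E i := by
    ext1 ω
    exact ((stdOrthonormalBasis ℝ E).sum_repr' (φ ω)).symm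
  rw [hsum]
  exact Finset.measurable_sum _ fun i _ => (hinner _).smul_const _

end MeasurableSelection

/-! ### The Young integral via integration by parts. -/

section YoungIntegral

variable {E : Type*} [NormedAddCommGroup E] [NormedSpace ℝ E]

lemma HasYoungIntegral.unique {f : ℝ → E} {g : ℝ → ℝ} {s t : ℝ} (hst : s ≤ t) {I J : E}
    (hI : HasYoungIntegral f g s t I) (hJ : HasYoungIntegral f g s t J) : I = J := by
  refine eq_of_forall_dist_le fun ε hε => ?_
  obtain ⟨δ₁, hδ₁, h₁⟩ := hI (ε / 2) (half_pos hε)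
  obtain ⟨δ₂, hδ₂, h₂⟩ := hJ (ε / 2) (half_pos hε)
  obtain ⟨P, hP⟩ := exists_intervalPartition_mesh_lt hst (lt_min hδ₁ hδ₂)
  have h₁ := h₁ P fun i hi => (hP i hi).trans_le (min_le_left _ _)
  have h₂ := h₂ P fun i hi => (hP i hi).trans_le (min_le_right _ _)
  rw [← dist_eq_norm] at h₁ h₂
  have := dist_triangle_left I J
    (∑ i ∈ Finset.range P.n, (g (P.pt (i + 1)) - g (P.pt i)) • f (P.pt i))
  linarith

lemma HasYoungIntegral.add {f₁ f₂ : ℝ → E} {g : ℝ → ℝ} {s t : ℝ} {I₁ I₂ : E}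
    (h₁ : HasYoungIntegral f₁ g s t I₁) (h₂ : HasYoungIntegral f₂ g s t I₂) :
    HasYoungIntegral (f₁ + f₂) g s t (I₁ + I₂) := by
  intro ε hε
  obtain ⟨δ₁, hδ₁, h₁⟩ := h₁ (ε / 2) (half_pos hε)
  obtain ⟨δ₂, hδ₂, h₂⟩ := h₂ (ε / 2) (half_pos hε)
  refine ⟨min δ₁ δ₂, lt_min hδ₁ hδ₂, fun P hP => ?_⟩
  have h₁ := h₁ P fun i hi => (hP i hi).trans_le (min_le_left _ _)
  have h₂ := h₂ P fun i hi => (hP i hi).trans_le (min_le_right _ _)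
  simp only [Pi.add_apply, smul_add, Finset.sum_add_distrib]
  rw [add_sub_add_comm]
  linarith [norm_add_le
    (∑ i ∈ Finset.range P.n, (g (P.pt (i + 1)) - g (P.pt i)) • f₁ (P.pt i) - I₁)
    (∑ i ∈ Finset.range P.n, (g (P.pt (i + 1)) - g (P.pt i)) • f₂ (P.pt i) - I₂)]

/-- The value of `∫_s^t f dg` obtained by integration by parts, for `f` with derivative `φ`. -/
def partsIntegral (f φ : ℝ → E) (g : ℝ → ℝ) (s t : ℝ) : E :=
  g t • f t - g s • f s - ∫ u in s..t, g u • φ u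

lemma norm_integral_sub_smul_le {φ : ℝ → E} {g : ℝ → ℝ} {a b c η : ℝ} (hab : a ≤ b)
    (hφ : IntervalIntegrable φ volume a b) (h : ∀ u ∈ Icc a b, |g u - c| ≤ η) :
    ‖∫ u in a..b, (g u - c) • φ u‖ ≤ η * ∫ u in a..b, ‖φ u‖ := by
  rw [← intervalIntegral.integral_const_mul]
  refine intervalIntegral.norm_integral_le_of_norm_le hab ?_ (hφ.norm.const_mul η)
  refine Eventually.of_forall fun u hu => ?_
  rw [norm_smul, Real.norm_eq_abs]
  gcongr
  exact h u ⟨hu.1.le, hu.2⟩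

/-- On each subinterval the Riemann term differs from the parts formula by the integral of (g u - g
(right end)) • φ u. Uniform continuity of g makes the total error at most η * ∫‖φ‖. -/
lemma hasYoungIntegral_partsIntegral {f φ : ℝ → E} {g : ℝ → ℝ} {s t : ℝ} (hst : s ≤ t)
    (hφ : IntervalIntegrable φ volume s t)
    (hf : ∀ a ∈ Icc s t, ∀ b ∈ Icc s t, ∫ u in a..b, φ u = f b - f a)
    (hg : ContinuousOn g (Icc s t)) :
    HasYoungIntegral f g s t (partsIntegral f φ g s t) := by
  intro ε hε
  have hK : 0 ≤ ∫ u in s..t, ‖φ u‖ :=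
    intervalIntegral.integral_nonneg hst fun u _ => norm_nonneg _
  set K := ∫ u in s..t, ‖φ u‖
  have hη : 0 < ε / (K + 1) := by positivity
  set η := ε / (K + 1) with hη_def
  obtain ⟨δ, hδ, hgδ⟩ := Metric.uniformContinuousOn_iff.1
    (isCompact_Icc.uniformContinuousOn_of_continuous hg) η hη
  refine ⟨δ, hδ, fun P hP => ?_⟩
  have hmem : ∀ i ≤ P.n, P.pt i ∈ Icc s t := fun i hi => P.pt_mem hi
  have hInt : ∀ {ψ : ℝ → E}, IntervalIntegrable ψ volume s t → ∀ i < P.n,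
      IntervalIntegrable ψ volume (P.pt i) (P.pt (i + 1)) := by
    intro ψ hψ i hi
    refine hψ.mono_set ?_
    rw [uIcc_of_le hst]
    exact uIcc_subset_Icc (hmem i hi.le) (hmem (i + 1) hi)
  have hgφ : IntervalIntegrable (fun u => g u • φ u) volume s t :=
    hφ.continuousOn_smul (by rwa [uIcc_of_le hst])
  have htel : ∑ i ∈ Finset.range P.n,
      (g (P.pt (i + 1)) • f (P.pt (i + 1)) - g (P.pt i) • f (P.pt i)) = g t • f t - g s • f s := by
    rw [Finset.sum_range_sub fun i => g (P.pt i) • f (P.pt i), P.pt_zero, P.pt_last]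
  have hsplit : ∑ i ∈ Finset.range P.n, ∫ u in P.pt i..P.pt (i + 1), g u • φ u =
      ∫ u in s..t, g u • φ u := by
    rw [intervalIntegral.sum_integral_adjacent_intervals (hInt hgφ), P.pt_zero, P.pt_last]
  have hsplit' : ∑ i ∈ Finset.range P.n, ∫ u in P.pt i..P.pt (i + 1), ‖φ u‖ = K := by
    rw [intervalIntegral.sum_integral_adjacent_intervals (fun i hi => (hInt hφ i hi).norm),
      P.pt_zero, P.pt_last]
  have hdiff : ∑ i ∈ Finset.range P.n, (g (P.pt (i + 1)) - g (P.pt i)) • f (P.pt i) -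
      partsIntegral f φ g s t = ∑ i ∈ Finset.range P.n,
        ∫ u in P.pt i..P.pt (i + 1), (g u - g (P.pt (i + 1))) • φ u := by
    rw [partsIntegral, ← htel, ← hsplit, ← Finset.sum_sub_distrib, ← Finset.sum_sub_distrib]
    refine Finset.sum_congr rfl fun i hi => ?_
    have hi := Finset.mem_range.1 hi
    simp only [sub_smul]
    rw [intervalIntegral.integral_sub (hInt hgφ i hi)
      ((hInt hφ i hi).continuousOn_smul continuousOn_const),
      intervalIntegral.integral_smul, hf _ (hmem i hi.le) _ (hmem (i + 1) hi), smul_sub]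
    abel
  rw [hdiff]
  calc _ ≤ ∑ i ∈ Finset.range P.n, η * ∫ u in P.pt i..P.pt (i + 1), ‖φ u‖ := by
        refine norm_sum_le_of_le _ fun i hi => ?_
        have hi := Finset.mem_range.1 hi
        refine norm_integral_sub_smul_le (P.pt_lt i hi).le (hInt hφ i hi) fun u hu => ?_
        refine (hgδ u ⟨(hmem i hi.le).1.trans hu.1, hu.2.trans (hmem (i + 1) hi).2⟩ _
          (hmem (i + 1) hi) ?_).le
        rw [Real.dist_eq, abs_sub_comm, abs_of_nonneg (sub_nonneg.2 hu.2)]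
        linarith [hP i hi, hu.1]
    _ = η * K := by rw [← Finset.mul_sum, hsplit']
    _ < η * (K + 1) := by gcongr; linarith
    _ = ε := by rw [hη_def]; field_simp

lemma norm_partsIntegral_le {f φ : ℝ → E} {g : ℝ → ℝ} {s t α B G : ℝ} (hst : s ≤ t)
    (hα : 0 < α) (hG : 0 ≤ G)
    (hφ : IntervalIntegrable φ volume s t) (hf : ∫ u in s..t, φ u = f t - f s)
    (hg : ContinuousOn g (Icc s t))
    (hgα : ∀ a ∈ Icc s t, ∀ b ∈ Icc s t, a ≤ b → |g b - g a| ≤ G * (b - a) ^ α)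
    (hB : ‖f s‖ + ∫ u in s..t, ‖φ u‖ ≤ B) :
    ‖partsIntegral f φ g s t‖ ≤ G * (t - s) ^ α * B := by
  have hgφ : IntervalIntegrable (fun u => g u • φ u) volume s t :=
    hφ.continuousOn_smul (by rwa [uIcc_of_le hst])
  -- The error identity for the one-interval partition, which brings in only increments of g.
  have heq : partsIntegral f φ g s t = (g t - g s) • f s - ∫ u in s..t, (g u - g t) • φ u := by
    simp only [sub_smul]
    rw [intervalIntegral.integral_sub hgφ (hφ.continuousOn_smul continuousOn_const),
      intervalIntegral.integral_smul, hf, smul_sub, partsIntegral]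
    abel
  have h1 : ‖(g t - g s) • f s‖ ≤ G * (t - s) ^ α * ‖f s‖ := by
    rw [norm_smul, Real.norm_eq_abs]
    gcongr
    exact hgα s ⟨le_rfl, hst⟩ t ⟨hst, le_rfl⟩ hst
  have h2 : ‖∫ u in s..t, (g u - g t) • φ u‖ ≤ G * (t - s) ^ α * ∫ u in s..t, ‖φ u‖ := by
    refine norm_integral_sub_smul_le hst hφ fun u hu => ?_
    rw [abs_sub_comm]
    refine (hgα u hu t ⟨hst, le_rfl⟩ hu.2).trans ?_
    gcongr
    · linarith [hu.2]
    · exact hu.1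
  rw [heq]
  refine (norm_sub_le _ _).trans ((add_le_add h1 h2).trans ?_)
  rw [← mul_add]
  have : 0 ≤ (t - s) ^ α := Real.rpow_nonneg (sub_nonneg.2 hst) _
  gcongr

lemma partsIntegral_sub_partsIntegral {f φ : ℝ → E} {g : ℝ → ℝ} {r s t : ℝ}
    (h₁ : IntervalIntegrable (fun u => g u • φ u) volume r s)
    (h₂ : IntervalIntegrable (fun u => g u • φ u) volume s t) :
    partsIntegral f φ g r t - partsIntegral f φ g r s = partsIntegral f φ g s t := by
  simp only [partsIntegral, ← intervalIntegral.integral_add_adjacent_intervals h₁ h₂]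
  abel

end YoungIntegral

/-! ### Hölder norms. -/

section Holder

variable {E : Type*} [NormedAddCommGroup E] {T α : ℝ}

lemma MemHolder.exists_abs_sub_le {g : ℝ → E} (hα : 0 < α) (hg : MemHolder T α g) :
    ∃ G : ℝ, 0 ≤ G ∧ ∀ a ∈ Icc 0 T, ∀ b ∈ Icc 0 T, a ≤ b → ‖g b - g a‖ ≤ G * (b - a) ^ α := by
  refine ⟨(holderNorm T α g).toReal, ENNReal.toReal_nonneg, fun a ha b hb hab => ?_⟩
  rcases hab.eq_or_lt with rfl | hab
  · simp [Real.zero_rpow hα.ne']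
  have hpos : 0 < (b - a) ^ α := Real.rpow_pos_of_pos (sub_pos.2 hab) _
  have h : ‖g b - g a‖ₑ / ENNReal.ofReal ((b - a) ^ α) ≤ holderNorm T α g := by
    refine le_trans ?_ (le_add_self (a := ⨆ s ∈ Icc 0 T, ⨆ t ∈ Icc 0 T, ⨆ _ : s < t,
      ‖g t - g s‖ₑ / ENNReal.ofReal ((t - s) ^ α)))
    exact le_iSup₂_of_le a ha (le_iSup₂_of_le b hb (le_iSup_of_le hab le_rfl))
  have h' := ENNReal.toReal_mono (LT.lt.ne hg) h
  rw [ENNReal.toReal_div, ENNReal.toReal_ofReal hpos.le, toReal_enorm] at h'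
  rwa [div_le_iff₀ hpos] at h'

lemma continuousOn_of_norm_sub_le_rpow {g : ℝ → E} {G : ℝ} (hα : 0 < α)
    (h : ∀ a ∈ Icc 0 T, ∀ b ∈ Icc 0 T, a ≤ b → ‖g b - g a‖ ≤ G * (b - a) ^ α) :
    ContinuousOn g (Icc 0 T) := by
  intro a ha
  have hlim : Tendsto (fun b => G * |b - a| ^ α) (𝓝[Icc 0 T] a) (𝓝 0) := by
    have : ContinuousAt (fun b : ℝ => G * |b - a| ^ α) a := by
      refine continuousAt_const.mul (ContinuousAt.rpow_const (by fun_prop) (Or.inr hα.le))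
    simpa [ContinuousAt, Real.zero_rpow hα.ne'] using this.tendsto.mono_left nhdsWithin_le_nhds
  rw [ContinuousWithinAt, tendsto_iff_norm_sub_tendsto_zero]
  refine squeeze_zero' (Eventually.of_forall fun _ => norm_nonneg _) ?_ hlim
  filter_upwards [self_mem_nhdsWithin] with b hb
  rcases le_total a b with hab | hab
  · rw [abs_of_nonneg (sub_nonneg.2 hab)]
    exact h a ha b hb hab
  · rw [abs_sub_comm, abs_of_nonneg (sub_nonneg.2 hab), norm_sub_rev]
    exact h b hb a ha hab

lemma holderNorm_le {f : ℝ → E} {A B : ℝ≥0∞} (hA : ∀ t ∈ Icc 0 T, ‖f t‖ₑ ≤ A)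
    (hB : ∀ s ∈ Icc 0 T, ∀ t ∈ Icc 0 T, s < t →
      ‖f t - f s‖ₑ / ENNReal.ofReal ((t - s) ^ α) ≤ B) : holderNorm T α f ≤ A + B :=
  add_le_add (iSup₂_le hA) (iSup₂_le fun s hs => iSup₂_le fun t ht => iSup_le fun h =>
    hB s hs t ht h)

lemma holderNorm_add_le (f h : ℝ → E) :
    holderNorm T α (f + h) ≤ holderNorm T α f + holderNorm T α h := by
  have key := holderNorm_le (T := T) (α := α) (f := f + h)
    (A := (⨆ t ∈ Icc 0 T, ‖f t‖ₑ) + ⨆ t ∈ Icc 0 T, ‖h t‖ₑ)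
    (B := (⨆ s ∈ Icc 0 T, ⨆ t ∈ Icc 0 T, ⨆ _ : s < t,
        ‖f t - f s‖ₑ / ENNReal.ofReal ((t - s) ^ α)) +
      ⨆ s ∈ Icc 0 T, ⨆ t ∈ Icc 0 T, ⨆ _ : s < t,
        ‖h t - h s‖ₑ / ENNReal.ofReal ((t - s) ^ α)) ?_ ?_
  · refine key.trans (le_of_eq ?_)
    simp only [holderNorm]
    abel
  · intro t ht
    exact (enorm_add_le _ _).trans (add_le_add
      (le_iSup₂ (f := fun t (_ : t ∈ Icc 0 T) => ‖f t‖ₑ) t ht)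
      (le_iSup₂ (f := fun t (_ : t ∈ Icc 0 T) => ‖h t‖ₑ) t ht))
  · intro s hs t ht hst
    refine le_trans ?_ (add_le_add
      (le_iSup₂_of_le s hs (le_iSup₂_of_le t ht (le_iSup_of_le hst le_rfl)))
      (le_iSup₂_of_le s hs (le_iSup₂_of_le t ht (le_iSup_of_le hst le_rfl))))
    rw [← ENNReal.add_div]
    gcongr
    simp only [Pi.add_apply, add_sub_add_comm]
    exact enorm_add_le _ _

end Holder

/-! ### Hukuhara derivatives through support functions. -/

section HukuharaDerivative

lemma HasHukuharaDerivAt.add {X : Type*} [NormedAddCommGroup X] [NormedSpace ℝ X] {T t : ℝ}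
    {F₁ F₂ : ℝ → ConvexBody X} {D₁ D₂ : ConvexBody X} (h₁ : HasHukuharaDerivAt T F₁ t D₁)
    (h₂ : HasHukuharaDerivAt T F₂ t D₂) : HasHukuharaDerivAt T (F₁ + F₂) t (D₁ + D₂) := by
  refine ⟨fun ht => ?_, fun ht => ?_⟩
  · obtain ⟨C₁, hC₁, hl₁⟩ := h₁.1 ht
    obtain ⟨C₂, hC₂, hl₂⟩ := h₂.1 ht
    refine ⟨fun h => C₁ h + C₂ h, ?_, by simpa using tendsto_convexBody_add hl₁ hl₂⟩
    filter_upwards [hC₁, hC₂] with h h₁ h₂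
    simp only [Pi.add_apply, h₁, h₂, add_add_add_comm]
  · obtain ⟨C₁, hC₁, hl₁⟩ := h₁.2 ht
    obtain ⟨C₂, hC₂, hl₂⟩ := h₂.2 ht
    refine ⟨fun h => C₁ h + C₂ h, ?_, by simpa using tendsto_convexBody_add hl₁ hl₂⟩
    filter_upwards [hC₁, hC₂] with h h₁ h₂
    simp only [Pi.add_apply, h₁, h₂, add_add_add_comm]

lemma HukuharaDifferentiable.add {X : Type*} [NormedAddCommGroup X] [NormedSpace ℝ X] {T : ℝ}
    {F₁ F₂ : ℝ → ConvexBody X} (h₁ : HukuharaDifferentiable T F₁)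
    (h₂ : HukuharaDifferentiable T F₂) : HukuharaDifferentiable T (F₁ + F₂) := fun t ht => by
  obtain ⟨D₁, hD₁⟩ := h₁ t ht
  obtain ⟨D₂, hD₂⟩ := h₂ t ht
  exact ⟨_, hD₁.add hD₂⟩

lemma HukuharaDifferentiable.hasHukuharaDerivAt {X : Type*} [NormedAddCommGroup X]
    [NormedSpace ℝ X] {T : ℝ} {F : ℝ → ConvexBody X} (h : HukuharaDifferentiable T F) {t : ℝ}
    (ht : t ∈ Icc 0 T) : HasHukuharaDerivAt T F t (hukuharaDeriv T F t) := by
  have := h t ht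
  rw [hukuharaDeriv, dif_pos this]
  exact this.choose_spec

lemma ae_mem_Ioo_of_restrict_Icc (a b : ℝ) : ∀ᵐ t ∂(volume.restrict (Icc a b)), t ∈ Ioo a b := by
  rw [← restrict_Ioo_eq_restrict_Icc]
  exact ae_restrict_mem measurableSet_Ioo

variable {E : Type*} [NormedAddCommGroup E] [InnerProductSpace ℝ E] {T : ℝ}

/-- By additivity and positive homogeneity of `supp`, the support value of h⁻¹ • C h is a one-sided
slope. Continuity in the Hausdorff metric passes to the limit on each side; both sides exist because
t is interior. -/
lemma HasHukuharaDerivAt.hasDerivAt_supp {F : ℝ → ConvexBody E} {t : ℝ} {D : ConvexBody E}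
    (h : HasHukuharaDerivAt T F t D) (ht : t ∈ Ioo 0 T) (ξ : E) :
    HasDerivAt (fun s => supp (F s) ξ) (supp D ξ) t := by
  rw [hasDerivAt_iff_tendsto_slope_left_right]
  constructor
  · obtain ⟨C, hC, hl⟩ := h.2 ht.1
    have hsub : Tendsto (fun y => t - y) (𝓝[<] t) (𝓝[>] 0) := by
      refine tendsto_nhdsWithin_iff.2 ⟨?_, ?_⟩
      · have : Tendsto (fun y => t - y) (𝓝 t) (𝓝 (t - t)) := by
          exact (continuous_const.sub continuous_id).tendsto t
        rw [sub_self] at this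
        exact this.mono_left nhdsWithin_le_nhds
      · filter_upwards [self_mem_nhdsWithin] with y hy
        exact mem_Ioi.2 (sub_pos.2 (mem_Iio.1 hy))
    refine (((lipschitzWith_supp_left ξ).continuous.tendsto D).comp (hl.comp hsub)).congr' ?_
    filter_upwards [hsub.eventually hC, self_mem_nhdsWithin] with y hy hyt
    have hyt : y < t := hyt
    rw [sub_sub_cancel] at hy
    have hpos : 0 < t - y := sub_pos.2 hyt
    simp only [Function.comp_apply, supp_smul (inv_pos.2 hpos).le, slope_def_field, hy, supp_add]
    have : y - t ≠ 0 := by linarith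
    field_simp
    ring
  · obtain ⟨C, hC, hl⟩ := h.1 ht.2
    have hsub : Tendsto (fun y => y - t) (𝓝[>] t) (𝓝[>] 0) := by
      refine tendsto_nhdsWithin_iff.2 ⟨?_, ?_⟩
      · have : Tendsto (fun y => y - t) (𝓝 t) (𝓝 (t - t)) := by
          exact (continuous_id.sub continuous_const).tendsto t
        rw [sub_self] at this
        exact this.mono_left nhdsWithin_le_nhds
      · filter_upwards [self_mem_nhdsWithin] with y hy
        exact mem_Ioi.2 (sub_pos.2 (mem_Ioi.1 hy))
    refine (((lipschitzWith_supp_left ξ).continuous.tendsto D).comp (hl.comp hsub)).congr' ?_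
    filter_upwards [hsub.eventually hC, self_mem_nhdsWithin] with y hy hyt
    have hyt : t < y := hyt
    rw [add_sub_cancel] at hy
    have hpos : 0 < y - t := sub_pos.2 hyt
    simp only [Function.comp_apply, supp_smul (inv_pos.2 hpos).le, slope_def_field, hy, supp_add]
    field_simp
    ring

/-- `hukuharaDeriv` is a choice, so its uniqueness matters: two Hukuhara derivatives have the same
support function, the derivative of a real function. -/
lemma HukuharaDifferentiable.hukuharaDeriv_add [CompleteSpace E] {F₁ F₂ : ℝ → ConvexBody E}
    (h₁ : HukuharaDifferentiable T F₁) (h₂ : HukuharaDifferentiable T F₂) {t : ℝ}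
    (ht : t ∈ Ioo 0 T) :
    hukuharaDeriv T (F₁ + F₂) t = hukuharaDeriv T F₁ t + hukuharaDeriv T F₂ t := by
  have ht' := Ioo_subset_Icc_self ht
  refine convexBody_ext_supp fun ξ => ?_
  exact (((h₁.add h₂).hasHukuharaDerivAt ht').hasDerivAt_supp ht ξ).unique
    (((h₁.hasHukuharaDerivAt ht').add (h₂.hasHukuharaDerivAt ht')).hasDerivAt_supp ht ξ)

lemma HukuharaDifferentiable.deriv_supp {F : ℝ → ConvexBody E} (h : HukuharaDifferentiable T F)
    {t : ℝ} (ht : t ∈ Ioo 0 T) (ξ : E) :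
    deriv (fun s => supp (F s) ξ) t = supp (hukuharaDeriv T F t) ξ :=
  ((h.hasHukuharaDerivAt (Ioo_subset_Icc_self ht)).hasDerivAt_supp ht ξ).deriv

variable {p : ℝ}

/-- Measurability comes for free: almost everywhere the function is the `deriv` of a real function.
-/
lemma HukuharaDifferentiable.memLp_supp {F : ℝ → ConvexBody E}
    (h : HukuharaDifferentiable T F) (hb : PIntegrablyBounded p T (hukuharaDeriv T F)) (ξ : E) :
    MemLp (fun t => supp (hukuharaDeriv T F t) ξ) (ENNReal.ofReal p)
      (volume.restrict (Icc 0 T)) := by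
  obtain ⟨k, hk, hFk⟩ := hb
  refine (hk.const_mul ‖ξ‖).of_le ?_ ?_
  · refine (measurable_deriv fun s => supp (F s) ξ).aestronglyMeasurable.congr ?_
    filter_upwards [ae_mem_Ioo_of_restrict_Icc 0 T] with t ht
    exact h.deriv_supp ht ξ
  · filter_upwards [hFk] with t ht
    rw [Real.norm_eq_abs, Real.norm_eq_abs]
    exact (abs_supp_le _ _).trans ((mul_le_mul_of_nonneg_left ht (norm_nonneg _)).trans
      (le_abs_self _))

lemma HukuharaDifferentiable.integral_supp_eq_sub {F : ℝ → ConvexBody E} (hp : 1 < p)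
    (hF : MemBV p T F) (h : HukuharaDifferentiable T F)
    (hb : PIntegrablyBounded p T (hukuharaDeriv T F)) (ξ : E) {t : ℝ} (ht : t ∈ Icc 0 T) :
    ∫ s in (0 : ℝ)..t, supp (hukuharaDeriv T F s) ξ = supp (F t) ξ - supp (F 0) ξ := by
  have hT : 0 ≤ T := ht.1.trans ht.2
  have hcont : ContinuousOn (fun s => supp (F s) ξ) (Icc 0 T) := by
    rw [← uIcc_of_le hT]
    exact (absolutelyContinuousOnInterval_comp_lipschitzWith (lipschitzWith_supp_left ξ)
      (hF.absolutelyContinuousOnInterval hp hT)).continuousOn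
  refine intervalIntegral.integral_eq_sub_of_hasDerivAt_of_le (f := fun s => supp (F s) ξ) ht.1
    (hcont.mono (Icc_subset_Icc le_rfl ht.2)) (fun s hs => ?_)
    (intervalIntegrable_of_memLp hp (h.memLp_supp hb ξ) ⟨le_rfl, hT⟩ ht)
  have hs' : s ∈ Ioo 0 T := ⟨hs.1, hs.2.trans_le ht.2⟩
  exact (h.hasHukuharaDerivAt (Ioo_subset_Icc_self hs')).hasDerivAt_supp hs' ξ

lemma HukuharaDifferentiable.add_integral_mem [CompleteSpace E] {F : ℝ → ConvexBody E}
    (hp : 1 < p) (hF : MemBV p T F) (h : HukuharaDifferentiable T F)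
    (hb : PIntegrablyBounded p T (hukuharaDeriv T F)) {φ : ℝ → E}
    (hφ : φ ∈ selL p T (hukuharaDeriv T F)) {x : E} (hx : x ∈ F 0) {t : ℝ} (ht : t ∈ Icc 0 T) :
    x + ∫ s in (0 : ℝ)..t, φ s ∈ F t := by
  have h0 : (0 : ℝ) ∈ Icc 0 T := ⟨le_rfl, ht.1.trans ht.2⟩
  have hInt := intervalIntegrable_of_memLp hp hφ.1 h0 ht
  refine mem_of_forall_inner_le_supp fun ξ => ?_
  have h1 := h.integral_supp_eq_sub hp hF hb ξ ht
  have h2 : inner ℝ ξ (∫ s in (0 : ℝ)..t, φ s) ≤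
      ∫ s in (0 : ℝ)..t, supp (hukuharaDeriv T F s) ξ := by
    rw [← innerSL_apply_apply ℝ ξ, ← ContinuousLinearMap.intervalIntegral_comp_comm _ hInt]
    refine intervalIntegral.integral_mono_ae_restrict ht.1
      ((intervalIntegrable_of_memLp hp ((innerSL ℝ ξ).comp_memLp' hφ.1) h0 ht))
      (intervalIntegrable_of_memLp hp (h.memLp_supp hb ξ) h0 ht) ?_
    have := ae_restrict_of_ae_restrict_of_subset (Icc_subset_Icc le_rfl ht.2) hφ.2
    filter_upwards [this] with s hs
    exact inner_le_supp ξ hs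
  rw [inner_add_right]
  linarith [inner_le_supp ξ hx]

end HukuharaDerivative

/-! ### Decomposing the selections of a sum. -/

section SelectionsOfSums

variable {E : Type*} [NormedAddCommGroup E] [InnerProductSpace ℝ E]
  {p T : ℝ} {F₁ F₂ : ℝ → ConvexBody E}

lemma MemBV.convexBody_add (hp : 1 < p) (h₁ : MemBV p T F₁) (h₂ : MemBV p T F₂) :
    MemBV p T (F₁ + F₂) :=
  MemBV.of_edist_le_add hp h₁ h₂ fun _ _ => convexBody_edist_add_add_le _ _ _ _

lemma PIntegrablyBounded.memLp {Φ : ℝ → ConvexBody E} (hΦ : PIntegrablyBounded p T Φ) {φ : ℝ → E}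
    (hφ : AEStronglyMeasurable φ (volume.restrict (Icc 0 T)))
    (hmem : ∀ᵐ t ∂(volume.restrict (Icc 0 T)), φ t ∈ Φ t) :
    MemLp φ (ENNReal.ofReal p) (volume.restrict (Icc 0 T)) := by
  obtain ⟨k, hk, hΦk⟩ := hΦ
  refine hk.of_le hφ ?_
  filter_upwards [hΦk, hmem] with t h₁ h₂
  exact (norm_le_dist_zero h₂).trans (h₁.trans (le_abs_self _))

variable [FiniteDimensional ℝ E]

lemma add_mem_IS (hT : 0 ≤ T) (hp : 1 < p) (hd₁ : HukuharaDifferentiable T F₁)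
    (hd₂ : HukuharaDifferentiable T F₂) {f₁ f₂ : ℝ → E} (hf₁ : f₁ ∈ IS p T F₁)
    (hf₂ : f₂ ∈ IS p T F₂) : f₁ + f₂ ∈ IS p T (F₁ + F₂) := by
  have hder : deriv f₁ + deriv f₂ =ᵐ[volume.restrict (Icc 0 T)] deriv (f₁ + f₂) := by
    filter_upwards [hf₁.1.1.ae_differentiableAt hp hT, hf₂.1.1.ae_differentiableAt hp hT]
      with t h₁ h₂
    exact (deriv_add h₁ h₂).symm
  refine ⟨⟨hf₁.1.1.of_edist_le_add hp hf₂.1.1 fun _ _ => edist_add_add_le _ _ _ _,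
    fun t ht => Set.add_mem_add (hf₁.1.2 t ht) (hf₂.1.2 t ht)⟩,
    (memLp_congr_ae hder).1 (hf₁.2.1.add hf₂.2.1), ?_⟩
  filter_upwards [hder, hf₁.2.2, hf₂.2.2, ae_mem_Ioo_of_restrict_Icc 0 T] with t ht h₁ h₂ hIoo
  rw [← ht, hd₁.hukuharaDeriv_add hd₂ hIoo]
  exact Set.add_mem_add h₁ h₂

/-- A measurable selection of a sum of Hukuhara derivatives is the sum of measurable selections. -/
lemma exists_measurable_mem_hukuharaDeriv [MeasurableSpace E] [BorelSpace E]
    (hd₁ : HukuharaDifferentiable T F₁) (hd₂ : HukuharaDifferentiable T F₂) {v : ℝ → E}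
    (hv : Measurable v) (hmem : ∀ᵐ t ∂(volume.restrict (Icc 0 T)),
      v t ∈ hukuharaDeriv T F₁ t + hukuharaDeriv T F₂ t) :
    ∃ φ : ℝ → E, Measurable φ ∧ ∀ᵐ t ∂(volume.restrict (Icc 0 T)),
      φ t ∈ hukuharaDeriv T F₁ t ∧ v t - φ t ∈ hukuharaDeriv T F₂ t := by
  -- The selection theorem needs solvability at every t, so the conditions are imposed only on a
  -- measurable set A of full measure and are void elsewhere.
  obtain ⟨A, hA, hAm, hAv⟩ :=
    (hmem.and (ae_mem_Ioo_of_restrict_Icc 0 T)).exists_measurable_mem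
  set q := TopologicalSpace.denseSeq E
  classical
  -- Both memberships are tested on a dense sequence of directions. The support values are written
  -- as derivatives, which makes them measurable in t.
  let c : ℕ → ℝ → E → ℝ := fun j t x =>
    if t ∈ A then max (inner ℝ (q j) x - deriv (fun s => supp (F₁ s) (q j)) t)
      (inner ℝ (q j) (v t - x) - deriv (fun s => supp (F₂ s) (q j)) t) else 0
  have hc : ∀ t ∈ A, ∀ x, (∀ j, c j t x ≤ 0) ↔
      x ∈ hukuharaDeriv T F₁ t ∧ v t - x ∈ hukuharaDeriv T F₂ t := by
    intro t ht x
    simp only [c, if_pos ht, max_le_iff, sub_nonpos, hd₁.deriv_supp (hAv t ht).2,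
      hd₂.deriv_supp (hAv t ht).2]
    exact ⟨fun h => ⟨mem_of_forall_denseSeq_inner_le_supp fun j => (h j).1,
      mem_of_forall_denseSeq_inner_le_supp fun j => (h j).2⟩,
      fun h j => ⟨inner_le_supp _ h.1, inner_le_supp _ h.2⟩⟩
  have hmeas : ∀ j x, Measurable fun t => c j t x := by
    intro j x
    refine Measurable.ite hAm (Measurable.max ?_ ?_) measurable_const
    · exact measurable_const.sub (measurable_deriv _)
    · exact (measurable_const.inner (hv.sub_const x)).sub (measurable_deriv _)
  have hcont : ∀ j t, Continuous (c j t) := by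
    intro j t
    by_cases ht : t ∈ A
    · simp only [c, if_pos ht]
      fun_prop
    · simp only [c, if_neg ht]
      fun_prop
  have hconv : ∀ t, Convex ℝ {x | ∀ j, c j t x ≤ 0} := by
    intro t
    by_cases ht : t ∈ A
    · simp only [hc t ht]
      intro x hx y hy a b ha hb hab
      refine ⟨(hukuharaDeriv T F₁ t).convex hx.1 hy.1 ha hb hab, ?_⟩
      have h := (hukuharaDeriv T F₂ t).convex hx.2 hy.2 ha hb hab
      have heq : a • (v t - x) + b • (v t - y) = v t - (a • x + b • y) := by
        have : v t = a • v t + b • v t := by rw [← add_smul, hab, one_smul]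
        conv_rhs => rw [this]
        module
      rwa [heq] at h
    · exact fun x _ y _ a b _ _ _ j => by simp only [c, if_neg ht, le_refl]
  have hne : ∀ t, ∃ x, ∀ j, c j t x ≤ 0 := by
    intro t
    by_cases ht : t ∈ A
    · obtain ⟨a, ha, b, hb, hab⟩ := (hAv t ht).1
      refine ⟨a, (hc t ht a).2 ⟨ha, ?_⟩⟩
      rwa [← hab, add_sub_cancel_left]
    · exact ⟨0, fun j => by simp only [c, if_neg ht, le_refl]⟩
  obtain ⟨φ, hφ, hφc⟩ := exists_measurable_forall_le hmeas hcont hconv hne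
  refine ⟨φ, hφ, ?_⟩
  filter_upwards [hA] with t ht
  exact (hc t ht _).1 (hφc t)

lemma exists_add_eq_of_mem_IS_add (hT : 0 ≤ T) (hp : 1 < p) (hF₁ : MemBV p T F₁)
    (hF₂ : MemBV p T F₂) (hd₁ : HukuharaDifferentiable T F₁) (hd₂ : HukuharaDifferentiable T F₂)
    (hb₁ : PIntegrablyBounded p T (hukuharaDeriv T F₁))
    (hb₂ : PIntegrablyBounded p T (hukuharaDeriv T F₂)) {f : ℝ → E}
    (hf : f ∈ IS p T (F₁ + F₂)) : ∃ f₁ ∈ IS p T F₁, ∃ f₂ ∈ IS p T F₂, f = f₁ + f₂ := by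
  borelize E
  have h0 : (0 : ℝ) ∈ Icc 0 T := ⟨le_rfl, hT⟩
  obtain ⟨x₁, hx₁, x₂, hx₂, hx⟩ := hf.1.2 0 h0
  have hmem : ∀ᵐ t ∂(volume.restrict (Icc 0 T)),
      deriv f t ∈ hukuharaDeriv T F₁ t + hukuharaDeriv T F₂ t := by
    filter_upwards [hf.2.2, ae_mem_Ioo_of_restrict_Icc 0 T] with t ht hIoo
    rwa [← hd₁.hukuharaDeriv_add hd₂ hIoo]
  obtain ⟨φ, hφm, hφ⟩ := exists_measurable_mem_hukuharaDeriv hd₁ hd₂ (measurable_deriv f) hmem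
  have hφ₁ : φ ∈ selL p T (hukuharaDeriv T F₁) :=
    ⟨hb₁.memLp hφm.aestronglyMeasurable (hφ.mono fun t h => h.1), hφ.mono fun t h => h.1⟩
  have hφ₂ : deriv f - φ ∈ selL p T (hukuharaDeriv T F₂) :=
    ⟨hf.2.1.sub hφ₁.1, hφ.mono fun t h => h.2⟩
  -- The second summand is f - f₁ rather than x₂ + ∫(f' - φ): the two agree on [0, T], and the
  -- former gives f = f₁ + f₂ on all of ℝ.
  set f₁ : ℝ → E := fun t => x₁ + ∫ s in (0 : ℝ)..t, φ s with hf₁_def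
  have hf₁BV : MemBV p T f₁ := MemBV.const_add_integral hp hφ₁.1 x₁
  have hf₁' : ∀ᵐ t ∂(volume.restrict (Icc 0 T)), HasDerivAt f₁ (φ t) t := by
    have := (intervalIntegrable_of_memLp hp hφ₁.1 h0 ⟨hT, le_rfl⟩).ae_hasDerivAt_integral
    rw [uIcc_of_le hT] at this
    rw [ae_restrict_iff' measurableSet_Icc]
    filter_upwards [this] with t ht htT
    exact (ht htT 0 h0).const_add x₁
  have hd₁' : φ =ᵐ[volume.restrict (Icc 0 T)] deriv f₁ := hf₁'.mono fun t h => h.deriv.symm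
  have hd₂' : deriv f - φ =ᵐ[volume.restrict (Icc 0 T)] deriv (f - f₁) := by
    filter_upwards [hf₁', hf.1.1.ae_differentiableAt hp hT] with t h₁ h₂
    exact (h₂.hasDerivAt.sub h₁).deriv.symm
  have hf₁ : f₁ ∈ IS p T F₁ := by
    refine ⟨⟨hf₁BV, fun t ht => hd₁.add_integral_mem hp hF₁ hb₁ hφ₁ hx₁ ht⟩,
      (memLp_congr_ae hd₁').1 hφ₁.1, ?_⟩
    filter_upwards [hd₁', hφ₁.2] with t h₁ h₂
    rwa [← h₁]
  have hf₂ : f - f₁ ∈ IS p T F₂ := by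
    refine ⟨⟨hf.1.1.of_edist_le_add hp hf₁BV fun s t => ?_, fun t ht => ?_⟩,
      (memLp_congr_ae hd₂').1 hφ₂.1, ?_⟩
    · simp only [Pi.sub_apply, sub_eq_add_neg]
      refine (edist_add_add_le _ _ _ _).trans (le_of_eq ?_)
      rw [edist_neg_neg]
    · have h := hd₂.add_integral_mem hp hF₂ hb₂ hφ₂ hx₂ ht
      have hInt := hf.1.1.integral_deriv_eq_sub hp hf.2.1 h0 ht
      simp only [Pi.sub_apply] at h ⊢
      rw [intervalIntegral.integral_sub (intervalIntegrable_of_memLp hp hf.2.1 h0 ht)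
        (intervalIntegrable_of_memLp hp hφ₁.1 h0 ht), hInt, ← hx] at h
      convert h using 1
      simp only [hf₁_def]
      abel
    · filter_upwards [hd₂', hφ₂.2] with t h₁ h₂
      rwa [← h₁]
  exact ⟨f₁, hf₁, f - f₁, hf₂, (add_sub_cancel f₁ f).symm⟩

end SelectionsOfSums

/-! ### Uniform bounds and additivity of the set-valued integral. -/

section YoungIntegralOfSelections

variable {E : Type*} [NormedAddCommGroup E] [InnerProductSpace ℝ E] [FiniteDimensional ℝ E]
  {p T α : ℝ} {F : ℝ → ConvexBody E} {g : ℝ → ℝ}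

lemma hasYoungIntegral_of_mem_IS (hp : 1 < p) (hg : ContinuousOn g (Icc 0 T)) {f : ℝ → E}
    (hf : f ∈ IS p T F) {s t : ℝ} (hs : 0 ≤ s) (hst : s ≤ t) (ht : t ≤ T) :
    HasYoungIntegral f g s t (partsIntegral f (deriv f) g s t) := by
  have hsub : Icc s t ⊆ Icc 0 T := Icc_subset_Icc hs ht
  exact hasYoungIntegral_partsIntegral hst
    (intervalIntegrable_of_memLp hp hf.2.1 (hsub ⟨le_rfl, hst⟩) (hsub ⟨hst, le_rfl⟩))
    (fun a ha b hb => hf.1.1.integral_deriv_eq_sub hp hf.2.1 (hsub ha) (hsub hb)) (hg.mono hsub)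

/-- The selections in `IS(F)` are bounded and have uniformly bounded variation. -/
lemma exists_bound_of_mem_IS (hp : 1 < p) (hb : PIntegrablyBounded p T (hukuharaDeriv T F)) :
    ∃ B : ℝ, ∀ f ∈ IS p T F, ∀ s t, 0 ≤ s → s ≤ t → t ≤ T →
      ‖f s‖ + ∫ u in s..t, ‖deriv f u‖ ≤ B := by
  obtain ⟨k, hk, hFk⟩ := hb
  -- ‖f s‖ costs ‖F 0‖ plus ∫‖f'‖ over [0, s], which joins the integral over [s, t] inside [0, T].
  refine ⟨dist (F 0) 0 + ∫ u in (0 : ℝ)..T, k u, fun f hf s t hs hst ht => ?_⟩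
  have hT : 0 ≤ T := hs.trans (hst.trans ht)
  have h0 : (0 : ℝ) ∈ Icc 0 T := ⟨le_rfl, hT⟩
  have hTT : T ∈ Icc 0 T := ⟨hT, le_rfl⟩
  have hsm : s ∈ Icc 0 T := ⟨hs, hst.trans ht⟩
  have htm : t ∈ Icc 0 T := ⟨hs.trans hst, ht⟩
  have hInt : ∀ {a b : ℝ}, a ∈ Icc 0 T → b ∈ Icc 0 T →
      IntervalIntegrable (fun u => ‖deriv f u‖) volume a b := fun ha hb =>
    (intervalIntegrable_of_memLp hp hf.2.1 ha hb).norm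
  have h1 : ‖f s‖ ≤ dist (F 0) 0 + ∫ u in (0 : ℝ)..s, ‖deriv f u‖ := by
    have heq : f s = f 0 + ∫ u in (0 : ℝ)..s, deriv f u := by
      rw [hf.1.1.integral_deriv_eq_sub hp hf.2.1 h0 hsm, add_sub_cancel]
    rw [heq]
    exact (norm_add_le _ _).trans (add_le_add (norm_le_dist_zero (hf.1.2 0 h0))
      (intervalIntegral.norm_integral_le_integral_norm hs))
  have h2 : ∫ u in (0 : ℝ)..T, ‖deriv f u‖ ≤ ∫ u in (0 : ℝ)..T, k u := by
    refine intervalIntegral.integral_mono_ae_restrict hT (hInt h0 hTT)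
      (intervalIntegrable_of_memLp hp hk h0 hTT) ?_
    filter_upwards [hFk, hf.2.2] with u h₁ h₂
    exact (norm_le_dist_zero h₂).trans h₁
  have h3 := intervalIntegral.integral_add_adjacent_intervals (hInt h0 hsm) (hInt hsm htm)
  have h4 := intervalIntegral.integral_add_adjacent_intervals (hInt h0 htm) (hInt htm hTT)
  have h5 : 0 ≤ ∫ u in t..T, ‖deriv f u‖ :=
    intervalIntegral.integral_nonneg ht fun u _ => norm_nonneg _
  linarith

/-- The constant does not depend on f, so boundedness in the space and in the Hölder norm both
follow. -/
lemma exists_norm_partsIntegral_le (hp : 1 < p) (hα : 0 < α) (hg : MemHolder T α g)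
    (hb : PIntegrablyBounded p T (hukuharaDeriv T F)) :
    ∃ C : ℝ, 0 ≤ C ∧ ∀ f ∈ IS p T F, ∀ s t, 0 ≤ s → s ≤ t → t ≤ T →
      ‖partsIntegral f (deriv f) g s t‖ ≤ C * (t - s) ^ α := by
  obtain ⟨B, hB⟩ := exists_bound_of_mem_IS hp hb
  obtain ⟨G, hG, hGg⟩ := hg.exists_abs_sub_le hα
  have hgc : ContinuousOn g (Icc 0 T) := continuousOn_of_norm_sub_le_rpow hα hGg
  refine ⟨G * max B 0, by positivity, fun f hf s t hs hst ht => ?_⟩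
  have hsub : Icc s t ⊆ Icc 0 T := Icc_subset_Icc hs ht
  have hsm := hsub ⟨le_rfl, hst⟩
  have htm := hsub ⟨hst, le_rfl⟩
  refine (norm_partsIntegral_le (B := max B 0) hst hα hG
    (intervalIntegrable_of_memLp hp hf.2.1 hsm htm)
    (hf.1.1.integral_deriv_eq_sub hp hf.2.1 hsm htm) (hgc.mono hsub)
    (fun a ha b hb => hGg a (hsub ha) b (hsub hb))
    ((hB f hf s t hs hst ht).trans (le_max_left _ _))).trans (le_of_eq ?_)
  ring

lemma MemHolder.continuousOn (hα : 0 < α) (hg : MemHolder T α g) : ContinuousOn g (Icc 0 T) := by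
  obtain ⟨G, -, hGg⟩ := hg.exists_abs_sub_le hα
  exact continuousOn_of_norm_sub_le_rpow hα hGg

lemma isBounded_youngIntegrals (hp : 1 < p) (hα : 0 < α) (hg : MemHolder T α g)
    (hb : PIntegrablyBounded p T (hukuharaDeriv T F)) {s t : ℝ} (hs : 0 ≤ s) (hst : s ≤ t)
    (ht : t ≤ T) : Bornology.IsBounded {I | ∃ f ∈ IS p T F, HasYoungIntegral f g s t I} := by
  obtain ⟨C, -, hC⟩ := exists_norm_partsIntegral_le hp hα hg hb
  refine isBounded_iff_forall_norm_le.2 ⟨C * (t - s) ^ α, ?_⟩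
  rintro I ⟨f, hf, hI⟩
  rw [hI.unique hst (hasYoungIntegral_of_mem_IS hp (hg.continuousOn hα) hf hs hst ht)]
  exact hC f hf s t hs hst ht

lemma exists_holderNorm_le_of_mem_setYoungPath (hp : 1 < p) (hα : 0 < α) (hg : MemHolder T α g)
    (hb : PIntegrablyBounded p T (hukuharaDeriv T F)) :
    ∃ M : ℝ≥0∞, M < ⊤ ∧ ∀ h ∈ setYoungPath p T α F g, holderNorm T α h ≤ M := by
  obtain ⟨C, hC0, hC⟩ := exists_norm_partsIntegral_le hp hα hg hb
  have hgc := hg.continuousOn hα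
  -- The 1 pays for approximating h by an indefinite integral; the other two terms bound its
  -- supremum and its Hölder seminorm.
  refine ⟨1 + (ENNReal.ofReal (C * T ^ α) + ENNReal.ofReal C), by finiteness, fun h hh => ?_⟩
  obtain ⟨f, hf, k, hk, hhk⟩ := hh 1 one_pos
  have hkeq : ∀ t ∈ Icc 0 T, k t = partsIntegral f (deriv f) g 0 t := fun t ht =>
    (hk t ht).unique ht.1 (hasYoungIntegral_of_mem_IS hp hgc hf le_rfl ht.1 ht.2)
  have hkn : holderNorm T α k ≤ ENNReal.ofReal (C * T ^ α) + ENNReal.ofReal C := by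
    refine holderNorm_le (fun t ht => ?_) fun s hs t ht hst => ?_
    · rw [hkeq t ht, ← ofReal_norm]
      refine ENNReal.ofReal_le_ofReal ((hC f hf 0 t le_rfl ht.1 ht.2).trans ?_)
      rw [sub_zero]
      gcongr
      exacts [ht.1, ht.2]
    · have hT0 : (0 : ℝ) ∈ Icc 0 T := ⟨le_rfl, hs.1.trans hs.2⟩
      have hInt : ∀ {a b : ℝ}, a ∈ Icc 0 T → b ∈ Icc 0 T →
          IntervalIntegrable (fun u => g u • deriv f u) volume a b := fun ha hb =>
        (intervalIntegrable_of_memLp hp hf.2.1 ha hb).continuousOn_smul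
          (hgc.mono (uIcc_subset_Icc ha hb))
      rw [hkeq t ht, hkeq s hs, partsIntegral_sub_partsIntegral (hInt hT0 hs) (hInt hs ht)]
      refine ENNReal.div_le_of_le_mul ?_
      rw [← ENNReal.ofReal_mul hC0, ← ofReal_norm]
      exact ENNReal.ofReal_le_ofReal (hC f hf s t hs.1 hst.le ht.2)
  calc holderNorm T α h = holderNorm T α ((h - k) + k) := by rw [sub_add_cancel]
    _ ≤ holderNorm T α (h - k) + holderNorm T α k := holderNorm_add_le _ _
    _ ≤ _ := add_le_add hhk.le hkn

/-- Boundedness is essential: a sum of closed sets need not be closed, but a sum of compact sets is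
compact. -/
lemma closure_add_eq_of_isBounded {S₁ S₂ : Set E} (h₁ : Bornology.IsBounded S₁)
    (h₂ : Bornology.IsBounded S₂) : closure (S₁ + S₂) = closure S₁ + closure S₂ := by
  have : ProperSpace E := FiniteDimensional.proper ℝ E
  apply Subset.antisymm
  · exact closure_minimal (Set.add_subset_add subset_closure subset_closure)
      (h₁.isCompact_closure.add h₂.isCompact_closure).isClosed
  · rintro _ ⟨a, ha, b, hb, rfl⟩
    exact map_mem_closure₂ continuous_add ha hb fun a ha b hb => Set.add_mem_add ha hb

lemma setYoung_add {F₁ F₂ : ℝ → ConvexBody E} (hp : 1 < p) (hα : 0 < α) (hg : MemHolder T α g)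
    (hF₁ : MemBV p T F₁) (hF₂ : MemBV p T F₂) (hd₁ : HukuharaDifferentiable T F₁)
    (hd₂ : HukuharaDifferentiable T F₂) (hb₁ : PIntegrablyBounded p T (hukuharaDeriv T F₁))
    (hb₂ : PIntegrablyBounded p T (hukuharaDeriv T F₂)) {s t : ℝ} (hs : 0 ≤ s) (hst : s ≤ t)
    (ht : t ≤ T) :
    setYoung p T (F₁ + F₂) g s t = setYoung p T F₁ g s t + setYoung p T F₂ g s t := by
  have hT : 0 ≤ T := hs.trans (hst.trans ht)
  have hgc := hg.continuousOn hα
  rw [setYoung, setYoung, setYoung, ← closure_add_eq_of_isBounded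
    (isBounded_youngIntegrals hp hα hg hb₁ hs hst ht)
    (isBounded_youngIntegrals hp hα hg hb₂ hs hst ht)]
  congr 1
  ext I
  constructor
  · rintro ⟨f, hf, hI⟩
    obtain ⟨f₁, hf₁, f₂, hf₂, rfl⟩ :=
      exists_add_eq_of_mem_IS_add hT hp hF₁ hF₂ hd₁ hd₂ hb₁ hb₂ hf
    have h₁ := hasYoungIntegral_of_mem_IS hp hgc hf₁ hs hst ht
    have h₂ := hasYoungIntegral_of_mem_IS hp hgc hf₂ hs hst ht
    rw [hI.unique hst (h₁.add h₂)]
    exact Set.add_mem_add ⟨f₁, hf₁, h₁⟩ ⟨f₂, hf₂, h₂⟩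
  · rintro ⟨I₁, ⟨f₁, hf₁, h₁⟩, I₂, ⟨f₂, hf₂, h₂⟩, rfl⟩
    exact ⟨f₁ + f₂, add_mem_IS hT hp hd₁ hd₂ hf₁ hf₂, h₁.add h₂⟩

end YoungIntegralOfSelections

end SetYoung

end

open SetYoung in
/-- The first and second conjuncts say that the objects of the theorem are well defined: the Young
integrals exist, and `F₁ + F₂` belongs to the class for which the integral is defined. -/
theorem theorem7 {d : ℕ} {T p α : ℝ} (hT : 0 < T) (hp : 1 < p) (hα : α ≤ 1)
    (hpα : 1 < 1 / p + α) {g : ℝ → ℝ} (hg : MemHolder T α g)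
    {F F₁ F₂ : ℝ → ConvexBody (EuclideanSpace ℝ (Fin d))}
    (hF : MemBV p T F) (hF₁ : MemBV p T F₁) (hF₂ : MemBV p T F₂)
    (hdF : HukuharaDifferentiable T F) (hdF₁ : HukuharaDifferentiable T F₁)
    (hdF₂ : HukuharaDifferentiable T F₂)
    (hbF : PIntegrablyBounded p T (hukuharaDeriv T F))
    (hbF₁ : PIntegrablyBounded p T (hukuharaDeriv T F₁))
    (hbF₂ : PIntegrablyBounded p T (hukuharaDeriv T F₂)) :
    (∀ f ∈ IS p T F, ∀ s t : ℝ, 0 ≤ s → s ≤ t → t ≤ T → ∃ I, HasYoungIntegral f g s t I) ∧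
    (MemBV p T (F₁ + F₂) ∧ HukuharaDifferentiable T (F₁ + F₂)) ∧
    (∀ t ∈ Set.Icc 0 T,
      setYoung p T (F₁ + F₂) g 0 t = setYoung p T F₁ g 0 t + setYoung p T F₂ g 0 t) ∧
    (Bornology.IsBounded (F 0 : Set (EuclideanSpace ℝ (Fin d))) →
      (∃ M : ENNReal, M < ⊤ ∧ ∀ h ∈ setYoungPath p T α F g, holderNorm T α h ≤ M) ∧
      ∀ s t : ℝ, 0 ≤ s → s ≤ t → t ≤ T → Bornology.IsBounded (setYoung p T F g s t)) := by
  have hα0 : 0 < α := by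
    have : 1 / p < 1 := by rw [div_lt_one (by linarith)]; exact hp
    linarith
  refine ⟨fun f hf s t hs hst ht => ⟨_, hasYoungIntegral_of_mem_IS hp (hg.continuousOn hα0) hf hs
      hst ht⟩, ⟨hF₁.convexBody_add hp hF₂, hdF₁.add hdF₂⟩, fun t ht => ?_, fun _ => ⟨?_, ?_⟩⟩
  · exact setYoung_add hp hα0 hg hF₁ hF₂ hdF₁ hdF₂ hbF₁ hbF₂ le_rfl ht.1 ht.2
  · exact exists_holderNorm_le_of_mem_setYoungPath hp hα0 hg hbF
  · exact fun s t hs hst ht => (isBounded_youngIntegrals hp hα0 hg hbF hs hst ht).closure
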